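/- Let $\mathcal H_3$ be the fusion category over $\mathbb C$ with simple objects $1,\alpha,\alpha^*,\rho,{}_\alpha\rho,{}_{\alpha^*}\rho$, in which $\alpha\otimes\alpha=\alpha^*$, $\alpha\otimes\alpha^*=\alpha^*\otimes\alpha=1$, $\alpha^*\otimes\alpha^*=\alpha$, ${}_\alpha\rho=\alpha\otimes\rho=\rho\otimes\alpha^*$, ${}_{\alpha^*}\rho=\alpha^*\otimes\rho=\rho\otimes\alpha$ and $\rho\otimes\rho=1+\rho+{}_\alpha\rho+{}_{\alpha^*}\rho$, such that the full subcategory on the tensor powers of $\rho$ is a trivalent category: $\rho$ is symmetrically self-dual, with a rotationally invariant trivalent vertex that, together with cup and cap, generates all morphisms between tensor powers of $\rho$; the loop has the value $d_\rho=\frac{3+\sqrt{13}}2$, and the vertex is scaled so that the bigon is $\sqrt{d_\rho}$ times a strand. Choose a basis vertex in each nonzero space $V_c^{ab}=\mathrm{Hom}(c,a\otimes b)$ such that the vertices in $V_\rho^{\rho\rho}$ and $V_1^{\rho\rho}$ are the trivalent vertex and the cup, and those in $V_\rho^{1\rho}$ and $V_\rho^{\rho1}$ are the inverse unit constraints. Let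 $F_u^{xyz}$ be the matrices of the associator, defined by (left tree $u\to k\,z\to(x\,y)\,z$) $=\sum_j(F_u^{xyz})_{jk}$ (right tree $u\to x\,j\to x\,(y\,z)$), and suppose that they are all unitary. Write $(F_u^{xyz})^*$ for the adjoint matrix, and put $c_1=\frac{\sqrt{13}+7}{18}$ and $c_2=\frac{\sqrt{\sqrt{13}-2}}3$. Then for $x={}_\alpha\rho$ and for $x={}_{\alpha^*}\rho$ $$(F_\rho^{\rho\rho\rho})^*_{x\rho}\,(F_x^{\rho\rho\rho})_{\rho\rho}\,\sqrt{d_\rho}=c_1\,(F_\rho^{\rho\rho\rho})^*_{x1}+c_2\,(F_\rho^{\rho\rho\rho})^*_{x\rho}.$$ If moreover the chosen vertex in $V_\rho^{\rho x}$ is the rotation of the chosen vertex in $V_\rho^{x\rho}$ (its lower leg $\rho$ is bent up on the left, and its right upper leg $\rho$ is bent down on the right), then also $$(F_\rho^{\rho\rho\rho})^*_{x\rho}\,(F_x^{\rho\rho\rho})_{\rho\rho}\,\sqrt{d_\rho}=c_1\,(F_\rho^{\rho\rho\rho})_{x1}+c_2\,(F_\rho^{\rho\rho\rho})_{x\rho}.$$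 -/

import Mathlib

open CategoryTheory MonoidalCategory CategoryTheory.Limits

universe v u

attribute [local instance] Abelian.hasFiniteBiproducts in
/-- A fusion category over `ℂ`: a `ℂ`-linear rigid semisimple monoidal category with finitely many
simple objects up to isomorphism, finite-dimensional morphism spaces and simple tensor unit. -/
structure IsFusionCategory (C : Type u) [Category.{v} C] [Abelian C] [Linear ℂ C]
    [MonoidalCategory C] [MonoidalPreadditive C] [MonoidalLinear ℂ C] : Prop where
  rigid : Nonempty (RigidCategory C)
  finite_hom : ∀ X Y : C, FiniteDimensional ℂ (X ⟶ Y)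
  semisimple : ∀ X : C, ∃ (n : ℕ) (s : Fin n → C),
    (∀ i, Simple (s i)) ∧ Nonempty (X ≅ ⨁ s)
  finite_simples : ∃ (n : ℕ) (s : Fin n → C), ∀ X : C, Simple X → ∃ i, Nonempty (X ≅ s i)
  unit_simple : Simple (𝟙_ C)

/-! ### Labels and fusion rules -/

/-- The six labels `1, α, α*, ρ, _αρ, _{α*}ρ`. -/
inductive H3Label
  | one | al | alS | rho | alRho | alSRho
  deriving DecidableEq

namespace H3Label

instance : Fintype H3Label :=
  ⟨{one, al, alS, rho, alRho, alSRho}, fun x => by cases x <;> decide⟩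

/-- The fusion table: `fusion a b` is the set of the labels `c` that occur in `a ⊗ b`
(each of them occurs exactly once). -/
def fusion : H3Label → H3Label → Finset H3Label
  | one, b => {b}
  | a, one => {a}
  | al, al => {alS}
  | al, alS => {one}
  | al, rho => {alRho}
  | al, alRho => {alSRho}
  | al, alSRho => {rho}
  | alS, al => {one}
  | alS, alS => {al}
  | alS, rho => {alSRho}
  | alS, alRho => {rho}
  | alS, alSRho => {alRho}
  | rho, al => {alSRho}
  | rho, alS => {alRho}
  | rho, rho => {one, rho, alRho, alSRho}
  | rho, alRho => {alS, rho, alRho, alSRho}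
  | rho, alSRho => {al, rho, alRho, alSRho}
  | alRho, al => {rho}
  | alRho, alS => {alSRho}
  | alRho, rho => {al, rho, alRho, alSRho}
  | alRho, alRho => {one, rho, alRho, alSRho}
  | alRho, alSRho => {alS, rho, alRho, alSRho}
  | alSRho, al => {alRho}
  | alSRho, alS => {rho}
  | alSRho, rho => {alS, rho, alRho, alSRho}
  | alSRho, alRho => {al, rho, alRho, alSRho}
  | alSRho, alSRho => {one, rho, alRho, alSRho}

end H3Label

/-- The dimension `d_ρ = (3 + √13) / 2`. -/
noncomputable def dRho : ℝ := (3 + Real.sqrt 13) / 2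

/-! ### Trivalent vertices and the planar diagrams they generate -/

section Trivalent

variable {C : Type u} [Category.{v} C] [MonoidalCategory C]

/-- A symmetrically self-dual object `X` (unoriented cup and cap satisfying both zigzag identities)
with a trivalent vertex, drawn with one leg below and two legs above, that is invariant under
rotation: bending a leg down on the right and bending a leg down on the left give the same
morphism `X ⊗ X ⟶ X`. -/
structure TrivalentVertex (X : C) where
  pairing : ExactPairing X X
  vertex : X ⟶ X ⊗ X
  rotation_invariant :
    vertex ▷ X ≫ (α_ X X X).hom ≫ X ◁ pairing.evaluation' ≫ (ρ_ X).hom =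
      X ◁ vertex ≫ (α_ X X X).inv ≫ pairing.evaluation' ▷ X ≫ (λ_ X).hom

namespace TrivalentVertex

variable {X : C} (T : TrivalentVertex X)

def cup : 𝟙_ C ⟶ X ⊗ X := T.pairing.coevaluation'

def cap : X ⊗ X ⟶ 𝟙_ C := T.pairing.evaluation'

/-- The trivalent vertex drawn with two legs below and one leg above. -/
def merge : X ⊗ X ⟶ X :=
  T.vertex ▷ X ≫ (α_ X X X).hom ≫ X ◁ T.cap ≫ (ρ_ X).hom

/-- The rotation of a vertex with lower leg `X` and upper legs `Y, X` (from left to right) by which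
the lower leg becomes the left upper leg and the right upper leg becomes the lower leg. -/
def rotate {Y : C} (f : X ⟶ Y ⊗ X) : X ⟶ X ⊗ Y :=
  (λ_ X).inv ≫ T.cup ▷ X ≫ (α_ X X X).hom ≫ X ◁ (f ▷ X) ≫ X ◁ (α_ Y X X).hom ≫
    X ◁ (Y ◁ T.cap) ≫ X ◁ (ρ_ Y).hom

end TrivalentVertex

/-- Bracketed tensor powers of one generator. -/
inductive TensorWord
  | unit : TensorWord
  | gen : TensorWord
  | tensor : TensorWord → TensorWord → TensorWord

/-- The bracketed tensor power of `X` described by a word. -/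
def TensorWord.eval (X : C) : TensorWord → C
  | .unit => 𝟙_ C
  | .gen => X
  | .tensor w w' => TensorWord.eval X w ⊗ TensorWord.eval X w'

variable [Preadditive C] [Linear ℂ C]

/-- The morphisms between tensor powers of `X` that are generated, as morphisms of a `ℂ`-linear
pivotal category, by the trivalent vertex: linear combinations of the composites and tensor products
of identities, structural isomorphisms, cup, cap and vertex. -/
inductive TrivalentVertex.Generated {X : C} (T : TrivalentVertex X) :
    (w w' : TensorWord) → (TensorWord.eval X w ⟶ TensorWord.eval X w') → Prop
  | id (w : TensorWord) : Generated T w w (𝟙 _)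
  | assoc_hom (w₁ w₂ w₃ : TensorWord) :
      Generated T (.tensor (.tensor w₁ w₂) w₃) (.tensor w₁ (.tensor w₂ w₃))
        (α_ (w₁.eval X) (w₂.eval X) (w₃.eval X)).hom
  | assoc_inv (w₁ w₂ w₃ : TensorWord) :
      Generated T (.tensor w₁ (.tensor w₂ w₃)) (.tensor (.tensor w₁ w₂) w₃)
        (α_ (w₁.eval X) (w₂.eval X) (w₃.eval X)).inv
  | left_unitor_hom (w : TensorWord) : Generated T (.tensor .unit w) w (λ_ (w.eval X)).hom
  | left_unitor_inv (w : TensorWord) : Generated T w (.tensor .unit w) (λ_ (w.eval X)).inv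
  | right_unitor_hom (w : TensorWord) : Generated T (.tensor w .unit) w (ρ_ (w.eval X)).hom
  | right_unitor_inv (w : TensorWord) : Generated T w (.tensor w .unit) (ρ_ (w.eval X)).inv
  | cup : Generated T .unit (.tensor .gen .gen) T.cup
  | cap : Generated T (.tensor .gen .gen) .unit T.cap
  | vertex : Generated T .gen (.tensor .gen .gen) T.vertex
  | comp {w₁ w₂ w₃ : TensorWord} {f : w₁.eval X ⟶ w₂.eval X} {g : w₂.eval X ⟶ w₃.eval X} :
      Generated T w₁ w₂ f → Generated T w₂ w₃ g → Generated T w₁ w₃ (f ≫ g)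
  | tensor {w₁ w₂ w₃ w₄ : TensorWord} {f : w₁.eval X ⟶ w₂.eval X} {g : w₃.eval X ⟶ w₄.eval X} :
      Generated T w₁ w₂ f → Generated T w₃ w₄ g →
        Generated T (.tensor w₁ w₃) (.tensor w₂ w₄) (f ⊗ₘ g)
  | zero (w w' : TensorWord) : Generated T w w' 0
  | add {w w' : TensorWord} {f g : w.eval X ⟶ w'.eval X} :
      Generated T w w' f → Generated T w w' g → Generated T w w' (f + g)
  | smul {w w' : TensorWord} (r : ℂ) {f : w.eval X ⟶ w'.eval X} :
      Generated T w w' f → Generated T w w' (r • f)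

end Trivalent

/-! ### The fusion category `H₃` -/

section H3

/-- Five objects named `α, α*, ρ, _αρ, _{α*}ρ`; the label `1` always denotes the tensor unit. -/
structure H3Objects (C : Type u) where
  al : C
  alS : C
  rho : C
  alRho : C
  alSRho : C

variable {C : Type u} [Category.{v} C] [MonoidalCategory C]

def H3Objects.obj (S : H3Objects C) : H3Label → C
  | .one => 𝟙_ C
  | .al => S.al
  | .alS => S.alS
  | .rho => S.rho
  | .alRho => S.alRho
  | .alSRho => S.alSRho

variable (C) in
/-- The structure of the fusion category `H₃` on `C`: `C` is a fusion category with simple objects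
`1, α, α*, ρ, _αρ, _{α*}ρ` and the fusion rules of `H₃`, and the full subcategory on the tensor
powers of `ρ` is a trivalent category, generated by a trivalent vertex, in which the loop has the
value `d_ρ`. The vertex is scaled so that the bigon has the value `√d_ρ`. -/
structure H3Category [Abelian C] [Linear ℂ C] [MonoidalPreadditive C] [MonoidalLinear ℂ C]
    extends H3Objects C where
  isFusion : IsFusionCategory C
  simple_obj : ∀ a : H3Label, Simple (toH3Objects.obj a)
  obj_injective : ∀ a b : H3Label, Nonempty (toH3Objects.obj a ≅ toH3Objects.obj b) → a = b
  exhaustive : ∀ Y : C, Simple Y → ∃ a : H3Label, Nonempty (Y ≅ toH3Objects.obj a)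
  fusion_rules : ∀ a b c : H3Label,
    Module.finrank ℂ (toH3Objects.obj c ⟶ toH3Objects.obj a ⊗ toH3Objects.obj b) =
      if c ∈ H3Label.fusion a b then 1 else 0
  triv : TrivalentVertex rho
  loop : triv.cup ≫ triv.cap = (dRho : ℂ) • 𝟙 (𝟙_ C)
  bigon : triv.vertex ≫ triv.merge = (Real.sqrt dRho : ℂ) • 𝟙 rho
  generated : ∀ (w w' : TensorWord) (f : w.eval rho ⟶ w'.eval rho), triv.Generated w w' f

/-! ### Fusion trees and `F`-symbols -/

variable [Abelian C] [Linear ℂ C] [MonoidalPreadditive C] [MonoidalLinear ℂ C]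

/-- A choice of basis vertices: `vert a b c` is a basis vector of `V_c^{ab} = Hom(c, a ⊗ b)` whenever
this space is nonzero. Lines labelled `1` can be attached to and removed from lines labelled `ρ`,
and the vertices with all legs in `{1, ρ}` are the cup and the trivalent vertex. -/
structure H3Category.Gauge (H : H3Category C) where
  vert : ∀ a b c : H3Label, H.obj c ⟶ H.obj a ⊗ H.obj b
  ne_zero : ∀ a b c : H3Label, c ∈ H3Label.fusion a b → vert a b c ≠ 0
  unit_left : vert .one .rho .rho = (λ_ H.rho).inv
  unit_right : vert .rho .one .rho = (ρ_ H.rho).inv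
  rho_cup : vert .rho .rho .one = H.triv.cup
  rho_vertex : vert .rho .rho .rho = H.triv.vertex

namespace H3Category.Gauge

variable {H : H3Category C} (V : H.Gauge)

/-- The tree `u → k z → (x y) z` in `Hom(u, (x ⊗ y) ⊗ z)`. -/
def leftTree (x y z u k : H3Label) : H.obj u ⟶ (H.obj x ⊗ H.obj y) ⊗ H.obj z :=
  V.vert k z u ≫ V.vert x y k ▷ H.obj z

/-- The tree `u → x j → x (y z)` in `Hom(u, x ⊗ (y ⊗ z))`. -/
def rightTree (x y z u j : H3Label) : H.obj u ⟶ H.obj x ⊗ (H.obj y ⊗ H.obj z) :=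
  V.vert x j u ≫ H.obj x ◁ V.vert y z j

/-- `k` is an admissible middle label of a left tree. -/
def LeftAdm (x y z u k : H3Label) : Prop := k ∈ H3Label.fusion x y ∧ u ∈ H3Label.fusion k z

/-- `j` is an admissible middle label of a right tree. -/
def RightAdm (x y z u j : H3Label) : Prop := j ∈ H3Label.fusion y z ∧ u ∈ H3Label.fusion x j

/-- `M` is the matrix of the associator with respect to the left and the right trees; rows are
labelled by right trees, columns by left trees, and entries with an inadmissible label are `0`. -/
structure IsFMatrix (x y z u : H3Label) (M : Matrix H3Label H3Label ℂ) : Prop where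
  expand : ∀ k, LeftAdm x y z u k →
    V.leftTree x y z u k ≫ (α_ (H.obj x) (H.obj y) (H.obj z)).hom =
      ∑ j, M j k • V.rightTree x y z u j
  zero : ∀ j k, ¬(RightAdm x y z u j ∧ LeftAdm x y z u k) → M j k = 0

open Classical in
/-- The `F`-matrix `F_u^{xyz}` (the trees with admissible labels are bases, so the matrix exists and
is unique). -/
noncomputable def F (x y z u : H3Label) : Matrix H3Label H3Label ℂ :=
  if h : ∃ M, V.IsFMatrix x y z u M then h.choose else 0

open Classical in
/-- All `F`-matrices, as maps between the spans of admissible labels, are unitary. -/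
def IsUnitary : Prop := ∀ x y z u : H3Label,
  V.F x y z u * (V.F x y z u).conjTranspose =
      Matrix.diagonal (fun j => if RightAdm x y z u j then (1 : ℂ) else 0) ∧
    (V.F x y z u).conjTranspose * V.F x y z u =
      Matrix.diagonal (fun k => if LeftAdm x y z u k then (1 : ℂ) else 0)

/-- The vertex `ρ → ρ x` is the rotation of the vertex `ρ → x ρ`; that is, the right tree
`ρ → ρ x → ρ (ρ ρ)` is the left tree `ρ → x ρ → (ρ ρ) ρ` rotated by one leg. -/
def RotationCompatible (x : H3Label) : Prop :=
  V.vert .rho x .rho = H.triv.rotate (V.vert x .rho .rho)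

end H3Category.Gauge

end H3

/-- `c₁ = (√13 + 7) / 18`. -/
noncomputable def popC1 : ℝ := (Real.sqrt 13 + 7) / 18

/-- `c₂ = √(√13 - 2) / 3`. -/
noncomputable def popC2 : ℝ := Real.sqrt (Real.sqrt 13 - 2) / 3

/-! Everything is read off from one operator, the rung on `ρ ⊗ ρ`. The fusion rules have no
multiplicities, so it acts on each channel `k` of `ρ ⊗ ρ` by a scalar `h k`. Diagram moves identify
these scalars with associator entries. An exchanged `ρ` gives `(F_k^{ρρρ})_{ρρ} √d = h k`
(`F_rho_self`), and a cup pushed through a rung gives `(F_ρ^{ρρρ})*_{kρ} = h k (F_ρ^{ρρρ})*_{k1}`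
(`star_F_rho_eq`). The first claim is therefore `h k ^ 2 = c₁ + c₂ h k` times an entry
(`F_relation`), and it remains to compute the eigenvalues on `_αρ` and `_{α*}ρ`.

Zigzags and unitarity determine the moduli of the row `(F_ρ^{ρρρ})_{1k}` (`normSq_F_one`). With
these as weights, unitarity and one exchange of rungs give three moment equations for the
eigenvalues `√d (1, a, p, q)` on `1, ρ, _αρ, _{α*}ρ` (`exists_rungEigenvalues`). Writing `e = 1/d`,
they leave `a = 0`, `a = (2 - e)/3` or `a = -(1 + 2e)/3` (`RungEigenvalues.cases`).

The value `a = 0` contradicts unitarity of `F_{αρ}^{ρρρ}` and its rotated companion `F_ρ^{αρ,ρ,ρ}`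
(`rungEigenvalue_ne_zero`). The value `(2 - e)/3` forces `p = q`. The rung is then a combination of
simpler diagrams, the vertex generates too few morphisms from `1` to the fourth power of `ρ`, and a
nonzero functional kills all of them (`rungEigenvalue_ne`). In the remaining case the sum and
product of `p` and `q` give the quadratic equation with coefficients `c₁, c₂`.

For the second claim, rotation by one leg exchanges left and right trees. It thus equates entries of
`F_ρ^{ρρρ}` with entries of its adjoint (`F_eq_star_of_rotate`). -/

/-! ### Planar calculus of cup, cap, vertex and rung -/

namespace TrivalentVertex

variable {C : Type u} [Category.{v} C] [MonoidalCategory C] {X : C} (T : TrivalentVertex X)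

/-- The rung between two vertical strands. -/
def rung : X ⊗ X ⟶ X ⊗ X :=
  T.vertex ▷ X ≫ (α_ X X X).hom ≫ X ◁ T.merge

theorem cup_cap_left : X ◁ T.cup ≫ (α_ X X X).inv ≫ T.cap ▷ X = (ρ_ X).hom ≫ (λ_ X).inv :=
  T.pairing.coevaluation_evaluation'

theorem cup_cap_right : T.cup ▷ X ≫ (α_ X X X).hom ≫ X ◁ T.cap = (λ_ X).hom ≫ (ρ_ X).inv :=
  T.pairing.evaluation_coevaluation'

theorem merge_eq_left :
    T.merge = X ◁ T.vertex ≫ (α_ X X X).inv ≫ T.cap ▷ X ≫ (λ_ X).hom :=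
  T.rotation_invariant

theorem merge_eq_right :
    T.merge = T.vertex ▷ X ≫ (α_ X X X).hom ≫ X ◁ T.cap ≫ (ρ_ X).hom := rfl

/-- By rotation invariance and interchange, the horizontal strand may be emitted from either side.
-/
theorem rung_eq : T.rung = X ◁ T.vertex ≫ (α_ X X X).inv ≫ T.merge ▷ X := by
  have h : T.vertex ▷ X ⊗≫ (X ⊗ X) ◁ T.vertex ⊗≫ X ◁ T.cap ▷ X ⊗≫ 𝟙 (X ⊗ X) =
      X ◁ T.vertex ⊗≫ T.vertex ▷ (X ⊗ X) ⊗≫ X ◁ T.cap ▷ X ⊗≫ 𝟙 (X ⊗ X) := by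
    have := whisker_exchange T.vertex T.vertex
    calc _ = (T.vertex ▷ X ≫ (X ⊗ X) ◁ T.vertex) ⊗≫ X ◁ T.cap ▷ X ⊗≫ 𝟙 (X ⊗ X) := by monoidal
      _ = _ := by rw [← this]; monoidal
  calc T.rung = T.vertex ▷ X ⊗≫ (X ⊗ X) ◁ T.vertex ⊗≫ X ◁ T.cap ▷ X ⊗≫ 𝟙 (X ⊗ X) := by
        rw [rung, merge_eq_left]; monoidal
    _ = _ := by rw [h, merge_eq_right]; monoidal

/-- The cup inserted to the right of `Y`. -/
def cupAt (Y : C) : Y ⟶ (Y ⊗ X) ⊗ X := (ρ_ Y).inv ≫ Y ◁ T.cup ≫ (α_ Y X X).inv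

/-- The cap to the right of `Y`. -/
def capAt (Y : C) : (Y ⊗ X) ⊗ X ⟶ Y := (α_ Y X X).hom ≫ Y ◁ T.cap ≫ (ρ_ Y).hom

/-- The trivalent vertex to the right of `Y`. -/
def vertAt (Y : C) : Y ⊗ X ⟶ (Y ⊗ X) ⊗ X := Y ◁ T.vertex ≫ (α_ Y X X).inv

/-- The inverted trivalent vertex to the right of `Y`. -/
def mergeAt (Y : C) : (Y ⊗ X) ⊗ X ⟶ Y ⊗ X := (α_ Y X X).hom ≫ Y ◁ T.merge

theorem cupAt_comp_capAt_whiskerRight (Y : C) :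
    T.cupAt (Y ⊗ X) ≫ T.capAt Y ▷ X = 𝟙 (Y ⊗ X) := by
  calc _ = 𝟙 (Y ⊗ X) ⊗≫ Y ◁ (X ◁ T.cup ≫ (α_ X X X).inv ≫ T.cap ▷ X) ⊗≫ 𝟙 (Y ⊗ X) := by
        rw [cupAt, capAt]; monoidal
    _ = _ := by rw [cup_cap_left]; monoidal

theorem cupAt_whiskerRight_comp_capAt (Y : C) :
    T.cupAt Y ▷ X ≫ T.capAt (Y ⊗ X) = 𝟙 (Y ⊗ X) := by
  calc _ = 𝟙 (Y ⊗ X) ⊗≫ Y ◁ (T.cup ▷ X ≫ (α_ X X X).hom ≫ X ◁ T.cap) ⊗≫ 𝟙 (Y ⊗ X) := by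
        rw [cupAt, capAt]; monoidal
    _ = _ := by rw [cup_cap_right]; monoidal

theorem vertAt_comp_capAt_whiskerRight (Y : C) :
    T.vertAt (Y ⊗ X) ≫ T.capAt Y ▷ X = T.mergeAt Y := by
  rw [mergeAt, merge_eq_left, vertAt, capAt]; monoidal

theorem vertAt_whiskerRight_comp_capAt (Y : C) :
    T.vertAt Y ▷ X ≫ T.capAt (Y ⊗ X) = T.mergeAt Y := by
  rw [mergeAt, merge_eq_right, vertAt, capAt]; monoidal

theorem cupAt_comp_mergeAt_whiskerRight (Y : C) :
    T.cupAt (Y ⊗ X) ≫ T.mergeAt Y ▷ X = T.vertAt Y := by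
  have h := whisker_exchange T.vertex T.cup
  calc _ = 𝟙 (Y ⊗ X) ⊗≫ Y ◁ (X ◁ T.cup ≫ T.vertex ▷ (X ⊗ X)) ⊗≫ Y ◁ X ◁ T.cap ▷ X ⊗≫
        𝟙 ((Y ⊗ X) ⊗ X) := by
        rw [cupAt, mergeAt, merge_eq_right]; monoidal
    _ = 𝟙 (Y ⊗ X) ⊗≫ Y ◁ T.vertex ⊗≫ Y ◁ X ◁ (X ◁ T.cup ≫ (α_ X X X).inv ≫ T.cap ▷ X) ⊗≫
        𝟙 ((Y ⊗ X) ⊗ X) := by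
        rw [h]; monoidal
    _ = _ := by rw [cup_cap_left, vertAt]; monoidal

theorem cupAt_whiskerRight_comp_mergeAt (Y : C) :
    T.cupAt Y ▷ X ≫ T.mergeAt (Y ⊗ X) = T.vertAt Y := by
  have h := whisker_exchange T.cup T.vertex
  calc _ = 𝟙 (Y ⊗ X) ⊗≫ Y ◁ (T.cup ▷ X ≫ (X ⊗ X) ◁ T.vertex) ⊗≫ Y ◁ X ◁ T.cap ▷ X ⊗≫
        𝟙 ((Y ⊗ X) ⊗ X) := by
        rw [cupAt, mergeAt, merge_eq_left]; monoidal
    _ = 𝟙 (Y ⊗ X) ⊗≫ Y ◁ T.vertex ⊗≫ Y ◁ (T.cup ▷ X ≫ (α_ X X X).hom ≫ X ◁ T.cap) ▷ X ⊗≫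
        𝟙 ((Y ⊗ X) ⊗ X) := by
        rw [← h]; monoidal
    _ = _ := by rw [cup_cap_right, vertAt]; monoidal

theorem vertAt_comp_mergeAt_whiskerRight (Y : C) :
    T.vertAt (Y ⊗ X) ≫ T.mergeAt Y ▷ X =
      (α_ Y X X).hom ≫ Y ◁ T.rung ≫ (α_ Y X X).inv := by
  rw [rung_eq, vertAt, mergeAt]; monoidal

theorem vertAt_whiskerRight_comp_mergeAt (Y : C) :
    T.vertAt Y ▷ X ≫ T.mergeAt (Y ⊗ X) =
      (α_ Y X X).hom ≫ Y ◁ T.rung ≫ (α_ Y X X).inv := by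
  rw [rung, vertAt, mergeAt]; monoidal

theorem merge_whiskerRight_comp_cap :
    T.merge ▷ X ≫ T.cap = (α_ X X X).hom ≫ X ◁ T.merge ≫ T.cap := by
  have h := whisker_exchange T.cap T.cap
  calc _ = 𝟙 ((X ⊗ X) ⊗ X) ⊗≫ X ◁ T.vertex ▷ X ⊗≫ (T.cap ▷ (X ⊗ X) ≫ 𝟙_ C ◁ T.cap) ⊗≫
        𝟙 (𝟙_ C) := by
        rw [merge_eq_left]; monoidal
    _ = 𝟙 ((X ⊗ X) ⊗ X) ⊗≫ X ◁ T.vertex ▷ X ⊗≫ ((X ⊗ X) ◁ T.cap ≫ T.cap ▷ 𝟙_ C) ⊗≫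
        𝟙 (𝟙_ C) := by
        rw [h]
    _ = _ := by rw [merge_eq_right]; monoidal

theorem rung_comp_cap : T.rung ≫ T.cap = (T.vertex ≫ T.merge) ▷ X ≫ T.cap := by
  rw [comp_whiskerRight, Category.assoc, merge_whiskerRight_comp_cap, rung]; simp

/-- The cap moves the absorbing vertex of the rung onto the third strand, so the result is two
successive merges. -/
theorem rung_whiskerRight_comp_cap :
    T.rung ▷ X ≫ (α_ X X X).hom ≫ X ◁ T.cap =
      (α_ X X X).hom ≫ X ◁ T.merge ≫ T.merge ≫ (ρ_ X).inv := by
  have h := whisker_exchange T.vertex T.merge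
  calc _ = T.vertex ▷ X ▷ X ⊗≫ X ◁ (T.merge ▷ X ≫ T.cap) ⊗≫ 𝟙 (X ⊗ 𝟙_ C) := by
        rw [rung]; monoidal
    _ = 𝟙 ((X ⊗ X) ⊗ X) ⊗≫ (T.vertex ▷ (X ⊗ X) ≫ (X ⊗ X) ◁ T.merge) ⊗≫ X ◁ T.cap ⊗≫
        𝟙 (X ⊗ 𝟙_ C) := by
        rw [merge_whiskerRight_comp_cap]; monoidal
    _ = _ := by rw [← h]; simp only [merge_eq_right T]; monoidal

/-- The rung between a strand `Y`, which emits `X` by `f`, and a strand `X`. -/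
def rungAt {Y : C} (f : Y ⟶ Y ⊗ X) : Y ⊗ X ⟶ Y ⊗ X :=
  f ▷ X ≫ (α_ Y X X).hom ≫ Y ◁ T.merge

/-- The vertex and the rung are slid to different heights; the rung between `Y` and `X` becomes an
emission from `Y`, and the vertex becomes part of a rung on the two right strands. -/
theorem vertex_comp_rungAt {Y : C} (f : Y ⟶ Y ⊗ X) :
    Y ◁ T.vertex ≫ (α_ Y X X).inv ≫ T.rungAt f ▷ X ≫ (α_ Y X X).hom =
      f ▷ X ≫ (α_ Y X X).hom ≫ Y ◁ T.rung := by
  have h := whisker_exchange f T.vertex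
  calc _ = (Y ◁ T.vertex ≫ f ▷ (X ⊗ X)) ⊗≫ Y ◁ T.merge ▷ X ⊗≫ 𝟙 (Y ⊗ (X ⊗ X)) := by
        rw [rungAt]; monoidal
    _ = _ := by rw [h, rung_eq]; monoidal

theorem cup_comp_rungAt {Y : C} (f : Y ⟶ Y ⊗ X) :
    (ρ_ Y).inv ≫ Y ◁ T.cup ≫ (α_ Y X X).inv ≫ T.rungAt f ▷ X ≫ (α_ Y X X).hom =
      f ≫ Y ◁ T.vertex := by
  have h := whisker_exchange f T.cup
  calc _ = 𝟙 Y ⊗≫ (Y ◁ T.cup ≫ f ▷ (X ⊗ X)) ⊗≫ Y ◁ T.merge ▷ X ⊗≫ 𝟙 (Y ⊗ (X ⊗ X)) := by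
        rw [rungAt]; monoidal
    _ = f ≫ (T.cupAt (Y ⊗ X) ≫ T.mergeAt Y ▷ X) ≫ (α_ Y X X).hom := by
        rw [h, cupAt, mergeAt]; monoidal
    _ = _ := by rw [cupAt_comp_mergeAt_whiskerRight, vertAt]; simp

theorem rotate_comp_whiskerRight {Y Z : C} (f : X ⟶ Y ⊗ X) (g : Y ⟶ Z) :
    T.rotate (f ≫ g ▷ X) = T.rotate f ≫ X ◁ g := by
  have h := whisker_exchange g T.cap
  calc _ = 𝟙 X ⊗≫ T.cup ▷ X ⊗≫ X ◁ f ▷ X ⊗≫ X ◁ (g ▷ (X ⊗ X) ≫ Z ◁ T.cap) ⊗≫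
        𝟙 (X ⊗ Z) := by
        rw [rotate]; monoidal
    _ = _ := by rw [← h, rotate]; monoidal

/-- The bent composite is a cup followed by a rung; choosing the other form of the rung lets the cup
be absorbed into a vertex. -/
theorem rotate_vertex_vertex :
    T.rotate (T.vertex ≫ X ◁ T.vertex ≫ (α_ X X X).inv) =
      T.vertex ≫ T.vertex ▷ X ≫ (α_ X X X).hom := by
  have h := T.cupAt_whiskerRight_comp_mergeAt (𝟙_ C)
  have h' := whisker_exchange T.cup T.vertex
  calc _ = 𝟙 X ⊗≫ T.cup ▷ X ⊗≫ X ◁ T.rung ⊗≫ 𝟙 (X ⊗ (X ⊗ X)) := by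
        rw [rotate, rung, merge_eq_right]; monoidal
    _ = 𝟙 X ⊗≫ (T.cup ▷ X ≫ (X ⊗ X) ◁ T.vertex) ⊗≫ X ◁ T.merge ▷ X ⊗≫
          𝟙 (X ⊗ (X ⊗ X)) := by
        rw [rung_eq]; monoidal
    _ = T.vertex ⊗≫ (T.cupAt (𝟙_ C) ▷ X ≫ T.mergeAt (𝟙_ C ⊗ X)) ▷ X ⊗≫
          𝟙 (X ⊗ (X ⊗ X)) := by
        rw [← h', cupAt, mergeAt]; monoidal
    _ = _ := by rw [h, vertAt]; monoidal

theorem rotate_cup :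
    T.rotate ((ρ_ X).inv ≫ X ◁ T.cup ≫ (α_ X X X).inv) =
      (λ_ X).inv ≫ T.cup ▷ X ≫ (α_ X X X).hom := by
  calc _ = 𝟙 X ⊗≫ T.cup ▷ X ⊗≫ X ◁ X ◁ (T.cup ▷ X ≫ (α_ X X X).hom ≫ X ◁ T.cap) ⊗≫
          𝟙 (X ⊗ (X ⊗ X)) := by
        rw [rotate]; monoidal
    _ = _ := by rw [cup_cap_right]; monoidal

end TrivalentVertex

/-! ### Semisimplicity, dual trees and the unitary change of basis -/

namespace H3Category

variable {C : Type u} [Category.{v} C] [MonoidalCategory C] [Abelian C] [Linear ℂ C]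
  [MonoidalPreadditive C] [MonoidalLinear ℂ C] (H : H3Category C)

/-- The trivalent vertex of `H`, as a vertex on the object with label `ρ`. -/
abbrev tri : TrivalentVertex (H.obj .rho) := H.triv

theorem hom_eq_zero {a b : H3Label} (hab : a ≠ b) (f : H.obj a ⟶ H.obj b) : f = 0 := by
  by_contra hf
  have := H.simple_obj a
  have := H.simple_obj b
  have := isIso_of_hom_simple hf
  exact hab (H.obj_injective a b ⟨asIso f⟩)

theorem id_ne_zero (a : H3Label) : 𝟙 (H.obj a) ≠ 0 :=
  have := H.simple_obj a
  CategoryTheory.id_nonzero (H.obj a)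

theorem smul_id_injective (a : H3Label) {r s : ℂ} (h : r • 𝟙 (H.obj a) = s • 𝟙 (H.obj a)) :
    r = s :=
  smul_left_injective ℂ (H.id_ne_zero a) h

attribute [local instance] Abelian.hasFiniteBiproducts in
-- Some component of `f` into a simple summand is nonzero, hence invertible by Schur's lemma.
theorem exists_retraction {c : H3Label} {Z : C} (f : H.obj c ⟶ Z) (hf : f ≠ 0) :
    ∃ g : Z ⟶ H.obj c, f ≫ g = 𝟙 _ := by
  obtain ⟨n, s, hs, ⟨e⟩⟩ := H.isFusion.semisimple Z
  have := H.simple_obj c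
  have : ∃ i, f ≫ e.hom ≫ biproduct.π s i ≠ 0 := by
    by_contra! h
    apply hf
    have h2 : f ≫ e.hom = 0 := by
      apply biproduct.hom_ext
      intro i
      simpa using h i
    rw [← cancel_mono e.hom, h2, zero_comp]
  obtain ⟨i, hi⟩ := this
  have := hs i
  have := isIso_of_hom_simple hi
  exact ⟨e.hom ≫ biproduct.π s i ≫ inv (f ≫ e.hom ≫ biproduct.π s i), by
    simpa only [Category.assoc] using IsIso.hom_inv_id (f ≫ e.hom ≫ biproduct.π s i)⟩

attribute [local instance] Abelian.hasFiniteBiproducts in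
theorem hom_ext_of_labels {Z W : C} {f g : Z ⟶ W}
    (h : ∀ (c : H3Label) (p : H.obj c ⟶ Z), p ≫ f = p ≫ g) : f = g := by
  obtain ⟨n, s, hs, ⟨e⟩⟩ := H.isFusion.semisimple Z
  rw [← cancel_epi e.inv]
  apply biproduct.hom_ext'
  intro i
  obtain ⟨c, ⟨φ⟩⟩ := H.exhaustive (s i) (hs i)
  have := h c (φ.inv ≫ biproduct.ι s i ≫ e.inv)
  rw [← cancel_epi φ.inv]
  simpa using this

namespace Gauge

variable {H} (V : H.Gauge)

theorem exists_smul_vert {a b c : H3Label} (hc : c ∈ H3Label.fusion a b)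
    (f : H.obj c ⟶ H.obj a ⊗ H.obj b) : ∃ r : ℂ, f = r • V.vert a b c := by
  have h1 : Module.finrank ℂ (H.obj c ⟶ H.obj a ⊗ H.obj b) = 1 := by
    rw [H.fusion_rules, if_pos hc]
  obtain ⟨r, hr⟩ := (finrank_eq_one_iff_of_nonzero' _ (V.ne_zero a b c hc)).1 h1 f
  exact ⟨r, hr.symm⟩

theorem _root_.H3Category.hom_tensor_eq_zero {a b c : H3Label} (hc : c ∉ H3Label.fusion a b)
    (f : H.obj c ⟶ H.obj a ⊗ H.obj b) : f = 0 := by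
  have h1 : Module.finrank ℂ (H.obj c ⟶ H.obj a ⊗ H.obj b) = 0 := by
    rw [H.fusion_rules, if_neg hc]
  have := H.isFusion.finite_hom (H.obj c) (H.obj a ⊗ H.obj b)
  have := Module.finrank_zero_iff.1 h1
  exact Subsingleton.elim _ _

/-- The chosen vertices span all maps from simple objects into `a ⊗ b`, and those maps detect
equality by semisimplicity. -/
theorem hom_ext {a b : H3Label} {W : C} {f g : H.obj a ⊗ H.obj b ⟶ W}
    (h : ∀ c ∈ H3Label.fusion a b, V.vert a b c ≫ f = V.vert a b c ≫ g) : f = g := by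
  apply H.hom_ext_of_labels
  intro c p
  by_cases hc : c ∈ H3Label.fusion a b
  · obtain ⟨r, rfl⟩ := V.exists_smul_vert hc p
    simp [h c hc]
  · simp [H3Category.hom_tensor_eq_zero hc p]

open Classical in
/-- The vertex `a ⊗ b → c` dual to the chosen vertex `c → a ⊗ b`. -/
noncomputable def dual (a b c : H3Label) : H.obj a ⊗ H.obj b ⟶ H.obj c :=
  if h : c ∈ H3Label.fusion a b then (H.exists_retraction _ (V.ne_zero a b c h)).choose else 0

@[simp] theorem vert_dual {a b c : H3Label} (hc : c ∈ H3Label.fusion a b) :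
    V.vert a b c ≫ V.dual a b c = 𝟙 _ := by
  rw [dual, dif_pos hc]
  exact (H.exists_retraction _ (V.ne_zero a b c hc)).choose_spec

theorem vert_dual_ne {a b c c' : H3Label} (h : c ≠ c') :
    V.vert a b c ≫ V.dual a b c' = 0 := H.hom_eq_zero h _

theorem sum_dual_vert (a b : H3Label) :
    ∑ c ∈ H3Label.fusion a b, V.dual a b c ≫ V.vert a b c = 𝟙 (H.obj a ⊗ H.obj b) := by
  apply V.hom_ext
  intro k hk
  rw [Preadditive.comp_sum, Finset.sum_eq_single_of_mem k hk]
  · rw [← Category.assoc, V.vert_dual hk]; simp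
  · intro c _ hck
    rw [← Category.assoc, V.vert_dual_ne hck.symm, zero_comp]

theorem exists_eigenvalue {a b : H3Label} (g : H.obj a ⊗ H.obj b ⟶ H.obj a ⊗ H.obj b) :
    ∃ κ : H3Label → ℂ, ∀ k ∈ H3Label.fusion a b, V.vert a b k ≫ g = κ k • V.vert a b k := by
  choose! κ hκ using fun k (hk : k ∈ H3Label.fusion a b) =>
    V.exists_smul_vert hk (V.vert a b k ≫ g)
  exact ⟨κ, hκ⟩

/-! #### Trees -/

variable {x y z u : H3Label}

/-- The functional dual to the left tree with middle label `k`. -/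
noncomputable def leftDual (x y z u k : H3Label) :
    (H.obj x ⊗ H.obj y) ⊗ H.obj z ⟶ H.obj u :=
  V.dual x y k ▷ H.obj z ≫ V.dual k z u

/-- The functional dual to the right tree with middle label `j`. -/
noncomputable def rightDual (x y z u j : H3Label) :
    H.obj x ⊗ (H.obj y ⊗ H.obj z) ⟶ H.obj u :=
  H.obj x ◁ V.dual y z j ≫ V.dual x j u

theorem leftTree_leftDual {k : H3Label} (hk : LeftAdm x y z u k) :
    V.leftTree x y z u k ≫ V.leftDual x y z u k = 𝟙 _ := by
  rw [leftTree, leftDual, Category.assoc, ← comp_whiskerRight_assoc, V.vert_dual hk.1]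
  simp [V.vert_dual hk.2]

theorem leftTree_leftDual_ne {k k' : H3Label} (hk : k ≠ k') :
    V.leftTree x y z u k ≫ V.leftDual x y z u k' = 0 := by
  rw [leftTree, leftDual, Category.assoc, ← comp_whiskerRight_assoc, V.vert_dual_ne hk]
  simp

theorem rightTree_rightDual {j : H3Label} (hj : RightAdm x y z u j) :
    V.rightTree x y z u j ≫ V.rightDual x y z u j = 𝟙 _ := by
  rw [rightTree, rightDual, Category.assoc, ← MonoidalCategory.whiskerLeft_comp_assoc,
    V.vert_dual hj.1]
  simp [V.vert_dual hj.2]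

theorem rightTree_rightDual_ne {j j' : H3Label} (hj : j ≠ j') :
    V.rightTree x y z u j ≫ V.rightDual x y z u j' = 0 := by
  rw [rightTree, rightDual, Category.assoc, ← MonoidalCategory.whiskerLeft_comp_assoc,
    V.vert_dual_ne hj]
  simp

theorem sum_leftTree_leftDual {k : H3Label} (hk : LeftAdm x y z u k) (a : H3Label → ℂ) :
    (∑ k, a k • V.leftTree x y z u k) ≫ V.leftDual x y z u k = a k • 𝟙 _ := by
  rw [Preadditive.sum_comp, Finset.sum_eq_single k]
  · rw [Linear.smul_comp, V.leftTree_leftDual hk]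
  · intro k' _ h
    rw [Linear.smul_comp, V.leftTree_leftDual_ne h, smul_zero]
  · simp

theorem sum_rightTree_rightDual {j : H3Label} (hj : RightAdm x y z u j) (a : H3Label → ℂ) :
    (∑ j, a j • V.rightTree x y z u j) ≫ V.rightDual x y z u j = a j • 𝟙 _ := by
  rw [Preadditive.sum_comp, Finset.sum_eq_single j]
  · rw [Linear.smul_comp, V.rightTree_rightDual hj]
  · intro k' _ h
    rw [Linear.smul_comp, V.rightTree_rightDual_ne h, smul_zero]
  · simp

theorem leftTree_coeff {a b : H3Label → ℂ}
    (h : ∑ k, a k • V.leftTree x y z u k = ∑ k, b k • V.leftTree x y z u k)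
    {k : H3Label} (hk : LeftAdm x y z u k) : a k = b k := by
  have := congrArg (· ≫ V.leftDual x y z u k) h
  simp only [V.sum_leftTree_leftDual hk] at this
  exact H.smul_id_injective _ this

theorem rightTree_coeff {a b : H3Label → ℂ}
    (h : ∑ j, a j • V.rightTree x y z u j = ∑ j, b j • V.rightTree x y z u j)
    {j : H3Label} (hj : RightAdm x y z u j) : a j = b j := by
  have := congrArg (· ≫ V.rightDual x y z u j) h
  simp only [V.sum_rightTree_rightDual hj] at this
  exact H.smul_id_injective _ this

instance (x y z u k : H3Label) : Decidable (LeftAdm x y z u k) := by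
  unfold LeftAdm; infer_instance

instance (x y z u k : H3Label) : Decidable (RightAdm x y z u k) := by
  unfold RightAdm; infer_instance

variable {V}

/-- Had `F` taken its default value `0`, the diagonal entry of `F F*` at an admissible label would
be `0` instead of `1`. -/
theorem IsUnitary.isFMatrix (hV : V.IsUnitary) {j : H3Label} (hj : RightAdm x y z u j) :
    V.IsFMatrix x y z u (V.F x y z u) := by
  by_cases h : ∃ M, V.IsFMatrix x y z u M
  · rw [F, dif_pos h]; exact h.choose_spec
  · have h0 : V.F x y z u = 0 := by rw [F, dif_neg h]
    have := congrFun (congrFun (hV x y z u).1 j) j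
    simp [h0, hj] at this

theorem IsUnitary.expand (hV : V.IsUnitary) {j : H3Label} (hj : RightAdm x y z u j) {k : H3Label}
    (hk : LeftAdm x y z u k) :
    V.leftTree x y z u k ≫ (α_ (H.obj x) (H.obj y) (H.obj z)).hom =
      ∑ j, V.F x y z u j k • V.rightTree x y z u j :=
  (hV.isFMatrix hj).expand k hk

theorem IsUnitary.row (hV : V.IsUnitary) {i j : H3Label} (hj : RightAdm x y z u j) :
    ∑ k, V.F x y z u i k * star (V.F x y z u j k) = if i = j then 1 else 0 := by
  have := congrFun (congrFun (hV x y z u).1 i) j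
  rw [Matrix.mul_apply] at this
  simp only [Matrix.conjTranspose_apply, Matrix.diagonal_apply] at this
  rw [this]
  split_ifs <;> simp_all

theorem IsUnitary.col (hV : V.IsUnitary) {k l : H3Label} (hk : LeftAdm x y z u k) :
    ∑ j, star (V.F x y z u j k) * V.F x y z u j l = if k = l then 1 else 0 := by
  have := congrFun (congrFun (hV x y z u).2 k) l
  rw [Matrix.mul_apply] at this
  simp only [Matrix.conjTranspose_apply, Matrix.diagonal_apply] at this
  rw [this]
  split_ifs <;> simp_all

theorem F_eq_zero {j k : H3Label} (h : ¬(RightAdm x y z u j ∧ LeftAdm x y z u k)) :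
    V.F x y z u j k = 0 := by
  by_cases h' : ∃ M, V.IsFMatrix x y z u M
  · rw [F, dif_pos h']; exact h'.choose_spec.zero j k h
  · rw [F, dif_neg h']; rfl

/-- The inverse associator has the inverse matrix, which by unitarity is the adjoint. -/
theorem IsUnitary.expand_inv (hV : V.IsUnitary) {j : H3Label} (hj : RightAdm x y z u j) :
    V.rightTree x y z u j ≫ (α_ (H.obj x) (H.obj y) (H.obj z)).inv =
      ∑ k, star (V.F x y z u j k) • V.leftTree x y z u k := by
  rw [← cancel_mono (α_ (H.obj x) (H.obj y) (H.obj z)).hom]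
  rw [Category.assoc, Iso.inv_hom_id, Category.comp_id, Preadditive.sum_comp]
  have h1 : ∀ k, (star (V.F x y z u j k) • V.leftTree x y z u k) ≫
      (α_ (H.obj x) (H.obj y) (H.obj z)).hom =
      ∑ i, (V.F x y z u i k * star (V.F x y z u j k)) • V.rightTree x y z u i := by
    intro k
    by_cases hk : LeftAdm x y z u k
    · rw [Linear.smul_comp, hV.expand hj hk, Finset.smul_sum]
      simp only [smul_smul, mul_comm]
    · have h0 : ∀ i, V.F x y z u i k = 0 := fun i => F_eq_zero (by tauto)
      simp [h0]
  simp only [h1]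
  rw [Finset.sum_comm]
  simp only [← Finset.sum_smul, hV.row hj, ite_smul, one_smul, zero_smul]
  simp

end Gauge

end H3Category

/-! ### Eigenvalues of the rung as entries of `F`-matrices -/

namespace H3Category

variable {C : Type u} [Category.{v} C] [MonoidalCategory C] [Abelian C] [Linear ℂ C]
  [MonoidalPreadditive C] [MonoidalLinear ℂ C] (H : H3Category C)

theorem cup_merge : H.tri.cup ≫ H.tri.merge = 0 :=
  H.hom_eq_zero (a := .one) (b := .rho) (by decide) _

theorem vertex_cap : H.tri.vertex ≫ H.tri.cap = 0 :=
  H.hom_eq_zero (a := .rho) (b := .one) (by decide) _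

theorem vertex_merge : H.tri.vertex ≫ H.tri.merge = (Real.sqrt dRho : ℂ) • 𝟙 (H.obj .rho) :=
  H.bigon

theorem cup_cap : H.tri.cup ≫ H.tri.cap = (dRho : ℂ) • 𝟙 (𝟙_ C) :=
  H.loop

/-- The cup as a morphism from the object with label `1`. -/
def cupOne : H.obj .one ⟶ H.obj .rho ⊗ H.obj .rho := H.tri.cup

/-- The cap as a morphism to the object with label `1`. -/
def capOne : H.obj .rho ⊗ H.obj .rho ⟶ H.obj .one := H.tri.cap

theorem cupOne_capOne : H.cupOne ≫ H.capOne = (dRho : ℂ) • 𝟙 (H.obj .one) :=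
  H.loop

theorem _root_.dRho_pos : 0 < dRho := by unfold dRho; positivity

theorem _root_.sqrt_dRho_pos : 0 < Real.sqrt dRho := Real.sqrt_pos.2 dRho_pos

theorem _root_.sqrt_dRho_sq : (Real.sqrt dRho : ℂ) * (Real.sqrt dRho : ℂ) = dRho := by
  rw [← Complex.ofReal_mul, Real.mul_self_sqrt dRho_pos.le]

theorem _root_.dRho_ne_zero : (dRho : ℂ) ≠ 0 := by
  exact_mod_cast dRho_pos.ne'

theorem _root_.sqrt_dRho_ne_zero : (Real.sqrt dRho : ℂ) ≠ 0 := by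
  exact_mod_cast sqrt_dRho_pos.ne'

theorem _root_.H3Label.mem_fusion_one (a : H3Label) : a ∈ H3Label.fusion a .one := by
  cases a <;> decide

namespace Gauge

variable {H} {V : H.Gauge}

variable (V) in
theorem vert_vertex : V.vert .rho .rho .rho = H.tri.vertex := V.rho_vertex

variable (V) in
theorem vert_cup : V.vert .rho .rho .one = H.cupOne := V.rho_cup

theorem vert_merge_ne {j : H3Label} (hj : j ≠ .rho) :
    V.vert .rho .rho j ≫ H.tri.merge = 0 := H.hom_eq_zero hj _

theorem vert_cap_ne {j : H3Label} (hj : j ≠ .one) :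
    V.vert .rho .rho j ≫ H.capOne = 0 := H.hom_eq_zero hj _

variable {Y u : H3Label}

theorem sum_rightTree_merge (a : H3Label → ℂ) :
    (∑ j, a j • V.rightTree Y .rho .rho u j) ≫ H.obj Y ◁ H.tri.merge =
      (a .rho * (Real.sqrt dRho : ℂ)) • V.vert Y .rho u := by
  rw [Preadditive.sum_comp, Finset.sum_eq_single .rho]
  · rw [Linear.smul_comp, rightTree, Category.assoc, ← MonoidalCategory.whiskerLeft_comp]
    have : V.vert .rho .rho .rho ≫ H.tri.merge = (Real.sqrt dRho : ℂ) • 𝟙 (H.obj .rho) := by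
      rw [V.vert_vertex]; exact H.vertex_merge
    rw [this]
    simp only [MonoidalLinear.whiskerLeft_smul, MonoidalCategory.whiskerLeft_id,
      Linear.comp_smul, Category.comp_id, smul_smul]
  · intro j _ hj
    rw [Linear.smul_comp, rightTree, Category.assoc, ← MonoidalCategory.whiskerLeft_comp,
      vert_merge_ne hj]
    simp
  · simp

theorem sum_rightTree_cap (a : H3Label → ℂ) :
    (∑ j, a j • V.rightTree Y .rho .rho u j) ≫ H.obj Y ◁ H.capOne =
      (a .one * (dRho : ℂ)) • V.vert Y .one u := by
  rw [Preadditive.sum_comp, Finset.sum_eq_single .one]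
  · rw [Linear.smul_comp, rightTree, Category.assoc, ← MonoidalCategory.whiskerLeft_comp]
    have : V.vert .rho .rho .one ≫ H.capOne = (dRho : ℂ) • 𝟙 (H.obj .one) := by
      rw [V.vert_cup]; exact H.cupOne_capOne
    rw [this]
    simp only [MonoidalLinear.whiskerLeft_smul, MonoidalCategory.whiskerLeft_id,
      Linear.comp_smul, Category.comp_id, smul_smul]
  · intro j _ hj
    rw [Linear.smul_comp, rightTree, Category.assoc, ← MonoidalCategory.whiskerLeft_comp,
      vert_cap_ne hj]
    simp
  · simp

theorem leftTree_eigenvalue {x y z u k : H3Label}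
    {g : H.obj x ⊗ H.obj y ⟶ H.obj x ⊗ H.obj y} {r : ℂ}
    (h : V.vert x y k ≫ g = r • V.vert x y k) :
    V.leftTree x y z u k ≫ g ▷ H.obj z = r • V.leftTree x y z u k := by
  rw [leftTree, Category.assoc, ← comp_whiskerRight, h]
  simp

theorem rightTree_eigenvalue {x y z u j : H3Label}
    {g : H.obj y ⊗ H.obj z ⟶ H.obj y ⊗ H.obj z} {r : ℂ}
    (h : V.vert y z j ≫ g = r • V.vert y z j) :
    V.rightTree x y z u j ≫ H.obj x ◁ g = r • V.rightTree x y z u j := by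
  rw [rightTree, Category.assoc, ← MonoidalCategory.whiskerLeft_comp, h]
  simp

/-- The coefficient of the `ρ`-exchange is an eigenvalue of the rung. -/
theorem IsUnitary.F_rho_self (hV : V.IsUnitary) (hY : Y ∈ H3Label.fusion Y .rho)
    (hu : u ∈ H3Label.fusion Y .rho) {κ : ℂ}
    (hκ : V.vert Y .rho u ≫ H.tri.rungAt (V.vert Y .rho Y) = κ • V.vert Y .rho u) :
    V.F Y .rho .rho u .rho Y * (Real.sqrt dRho : ℂ) = κ := by
  have hj : RightAdm Y .rho .rho u .rho := ⟨by decide, hu⟩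
  have hk : LeftAdm Y .rho .rho u Y := ⟨hY, hu⟩
  -- Merging the two right strands selects the right tree with middle label `ρ`, and turns the left
  -- tree into a rung.
  have h1 := congrArg (· ≫ H.obj Y ◁ H.tri.merge) (hV.expand hj hk)
  simp only [sum_rightTree_merge] at h1
  have h2 : V.vert Y .rho u ≫ H.tri.rungAt (V.vert Y .rho Y) =
      (V.F Y .rho .rho u .rho Y * (Real.sqrt dRho : ℂ)) • V.vert Y .rho u := by
    rw [← h1, leftTree, TrivalentVertex.rungAt]; simp
  have h3 := congrArg (· ≫ V.dual Y .rho u) (h2.symm.trans hκ)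
  simp only [Linear.smul_comp, V.vert_dual hu] at h3
  exact H.smul_id_injective _ h3

/-- Both sides expand one diagram in right trees: a vertex on the right followed by a rung on the
left two strands. Directly, the rung acts by `κ` between `F` and its adjoint; after
`vertex_comp_rungAt` it acts by `h` on the right two strands. -/
theorem IsUnitary.rung_exchange (hV : V.IsUnitary) (hY : Y ∈ H3Label.fusion Y .rho)
    (hu : u ∈ H3Label.fusion Y .rho) {κ h : H3Label → ℂ}
    (hκ : ∀ k ∈ H3Label.fusion Y .rho,
      V.vert Y .rho k ≫ H.tri.rungAt (V.vert Y .rho Y) = κ k • V.vert Y .rho k)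
    (hh : ∀ j ∈ H3Label.fusion .rho .rho,
      V.vert .rho .rho j ≫ H.tri.rung = h j • V.vert .rho .rho j)
    {j : H3Label} (hj : RightAdm Y .rho .rho u j) :
    ∑ k, V.F Y .rho .rho u j k * κ k * star (V.F Y .rho .rho u .rho k) =
      h j * V.F Y .rho .rho u j Y := by
  have hr : RightAdm Y .rho .rho u .rho := ⟨by decide, hu⟩
  have hk : LeftAdm Y .rho .rho u Y := ⟨hY, hu⟩
  have h1 : V.rightTree Y .rho .rho u .rho ≫ (α_ _ _ _).inv ≫
      H.tri.rungAt (V.vert Y .rho Y) ▷ H.obj .rho ≫ (α_ _ _ _).hom =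
      ∑ i, (∑ k, V.F Y .rho .rho u i k * κ k * star (V.F Y .rho .rho u .rho k)) •
        V.rightTree Y .rho .rho u i := by
    rw [reassoc_of% (hV.expand_inv hr), Preadditive.sum_comp]
    have : ∀ k, (star (V.F Y .rho .rho u .rho k) • V.leftTree Y .rho .rho u k) ≫
        H.tri.rungAt (V.vert Y .rho Y) ▷ H.obj .rho ≫ (α_ _ _ _).hom =
        ∑ i, (V.F Y .rho .rho u i k * κ k * star (V.F Y .rho .rho u .rho k)) •
          V.rightTree Y .rho .rho u i := by
      intro k
      by_cases hk : LeftAdm Y .rho .rho u k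
      · rw [Linear.smul_comp, ← Category.assoc, leftTree_eigenvalue (hκ k hk.1),
          Linear.smul_comp, hV.expand hj hk, Finset.smul_sum, Finset.smul_sum]
        refine Finset.sum_congr rfl fun i _ => ?_
        rw [smul_smul, smul_smul]
        congr 1; ring
      · have h0 : ∀ i, V.F Y .rho .rho u i k = 0 := fun i => F_eq_zero (by tauto)
        simp [h0]
    simp only [this]
    rw [Finset.sum_comm]
    simp only [Finset.sum_smul]
  have h2 : V.rightTree Y .rho .rho u .rho ≫ (α_ _ _ _).inv ≫
      H.tri.rungAt (V.vert Y .rho Y) ▷ H.obj .rho ≫ (α_ _ _ _).hom =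
      ∑ i, (h i * V.F Y .rho .rho u i Y) • V.rightTree Y .rho .rho u i := by
    have h3 := H.tri.vertex_comp_rungAt (V.vert Y .rho Y)
    have h4 : V.rightTree Y .rho .rho u .rho ≫ (α_ _ _ _).inv ≫
        H.tri.rungAt (V.vert Y .rho Y) ▷ H.obj .rho ≫ (α_ _ _ _).hom =
        (V.leftTree Y .rho .rho u Y ≫ (α_ _ _ _).hom) ≫ H.obj Y ◁ H.tri.rung := by
      rw [rightTree, leftTree, V.vert_vertex]
      simp only [Category.assoc]
      exact congrArg _ h3
    rw [h4, hV.expand hj hk, Preadditive.sum_comp]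
    refine Finset.sum_congr rfl fun i _ => ?_
    by_cases hi : RightAdm Y .rho .rho u i
    · rw [Linear.smul_comp, rightTree_eigenvalue (hh i hi.1), smul_smul, mul_comm]
    · have h0 : V.F Y .rho .rho u i Y = 0 := F_eq_zero (by tauto)
      simp [h0]
  exact V.rightTree_coeff (h1.symm.trans h2) hj

/-- Put a rung on the left tree and cap the right two strands. The cap selects the middle label `1`;
`rung_whiskerRight_comp_cap` replaces rung and cap by two merges, which select `ρ`. The factors
agree because `√d · √d = d`. -/
theorem IsUnitary.F_rho_eq (hV : V.IsUnitary) {h : ℂ} {k : H3Label}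
    (hk : LeftAdm .rho .rho .rho .rho k)
    (hh : V.vert .rho .rho k ≫ H.tri.rung = h • V.vert .rho .rho k) :
    V.F .rho .rho .rho .rho .rho k = h * V.F .rho .rho .rho .rho .one k := by
  have hj : RightAdm .rho .rho .rho .rho .rho := ⟨by decide, by decide⟩
  have h1 : V.leftTree .rho .rho .rho .rho k ≫ H.tri.rung ▷ H.obj .rho ≫ (α_ _ _ _).hom ≫
      H.obj .rho ◁ H.capOne =
      (h * (V.F .rho .rho .rho .rho .one k * (dRho : ℂ))) • V.vert .rho .one .rho := by
    rw [← Category.assoc, leftTree_eigenvalue hh, Linear.smul_comp,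
      reassoc_of% (hV.expand hj hk), sum_rightTree_cap]
    exact smul_smul _ _ _
  have h2 : V.leftTree .rho .rho .rho .rho k ≫ H.tri.rung ▷ H.obj .rho ≫ (α_ _ _ _).hom ≫
      H.obj .rho ◁ H.capOne =
      (V.F .rho .rho .rho .rho .rho k * (dRho : ℂ)) • V.vert .rho .one .rho := by
    have h0 : H.tri.rung ▷ H.obj .rho ≫ (α_ _ _ _).hom ≫ H.obj .rho ◁ H.capOne =
        (α_ _ _ _).hom ≫ H.obj .rho ◁ H.tri.merge ≫ H.tri.merge ≫ V.vert .rho .one .rho := by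
      rw [V.unit_right]
      exact H.tri.rung_whiskerRight_comp_cap
    rw [h0, reassoc_of% (hV.expand hj hk), ← Category.assoc, sum_rightTree_merge,
      Linear.smul_comp, V.vert_vertex]
    have h5 : H.tri.vertex ≫ H.tri.merge ≫ V.vert .rho .one .rho =
        (Real.sqrt dRho : ℂ) • V.vert .rho .one .rho := by
      rw [← Category.assoc, H.vertex_merge, Linear.smul_comp, Category.id_comp]
    rw [h5]
    rw [← sqrt_dRho_sq, ← mul_assoc]
    exact smul_smul _ _ _
  have h3 := congrArg (· ≫ V.dual .rho .one .rho) (h2.symm.trans h1)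
  simp only [Linear.smul_comp, V.vert_dual (show H3Label.rho ∈ H3Label.fusion .rho .one by decide)]
    at h3
  have h4 := H.smul_id_injective _ h3
  exact mul_right_cancel₀ dRho_ne_zero (h4.trans (mul_assoc _ _ _).symm)

/-- A rung on the first two strands of the right tree through `1` yields the right tree through `ρ`
(`cup_comp_rungAt`). In left trees that rung is diagonal. -/
theorem IsUnitary.star_F_rho_eq (hV : V.IsUnitary) {h : H3Label → ℂ}
    (hh : ∀ j ∈ H3Label.fusion .rho .rho,
      V.vert .rho .rho j ≫ H.tri.rung = h j • V.vert .rho .rho j)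
    {k : H3Label} (hk : LeftAdm .rho .rho .rho .rho k) :
    star (V.F .rho .rho .rho .rho .rho k) = h k * star (V.F .rho .rho .rho .rho .one k) := by
  have hr : RightAdm .rho .rho .rho .rho .rho := ⟨by decide, by decide⟩
  have h1 : RightAdm .rho .rho .rho .rho .one := ⟨by decide, by decide⟩
  have h2 : (V.rightTree .rho .rho .rho .rho .one ≫ (α_ _ _ _).inv) ≫ H.tri.rung ▷ H.obj .rho =
      V.rightTree .rho .rho .rho .rho .rho ≫ (α_ _ _ _).inv := by
    have := H.tri.cup_comp_rungAt H.tri.vertex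
    rw [rightTree, rightTree, V.unit_right, V.vert_cup, V.vert_vertex]
    rw [← cancel_mono (α_ _ _ _).hom]
    simp only [Category.assoc, Iso.inv_hom_id, Category.comp_id]
    exact (Category.assoc _ _ _).trans this
  rw [hV.expand_inv h1, hV.expand_inv hr, Preadditive.sum_comp] at h2
  have h3 : ∀ i, (star (V.F .rho .rho .rho .rho .one i) • V.leftTree .rho .rho .rho .rho i) ≫
      H.tri.rung ▷ H.obj .rho =
      (h i * star (V.F .rho .rho .rho .rho .one i)) • V.leftTree .rho .rho .rho .rho i := by
    intro i
    by_cases hi : LeftAdm .rho .rho .rho .rho i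
    · rw [Linear.smul_comp, leftTree_eigenvalue (hh i hi.1), smul_smul, mul_comm]
    · rw [F_eq_zero (by tauto)]; simp
  simp only [h3] at h2
  exact (V.leftTree_coeff h2 hk).symm

end Gauge

end H3Category

/-! ### Moduli of the entries with right middle label `1` -/

theorem TrivalentVertex.capAt_naturality {C : Type u} [Category.{v} C] [MonoidalCategory C] {X : C}
    (T : TrivalentVertex X) {Y Z : C} (g : Y ⟶ Z) :
    g ▷ X ▷ X ≫ T.capAt Z = T.capAt Y ≫ g := by
  calc _ = 𝟙 ((Y ⊗ X) ⊗ X) ⊗≫ (g ▷ (X ⊗ X) ≫ Z ◁ T.cap) ⊗≫ 𝟙 Z := by rw [capAt]; monoidal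
    _ = _ := by rw [← whisker_exchange, capAt]; monoidal

namespace H3Category

variable {C : Type u} [Category.{v} C] [MonoidalCategory C] [Abelian C] [Linear ℂ C]
  [MonoidalPreadditive C] [MonoidalLinear ℂ C] {H : H3Category C}

namespace Gauge

variable {V : H.Gauge} {Y z : H3Label}

/-- The inverse right unit constraint as a morphism to the product with the object with label `1`. -/
def _root_.H3Category.unitInv (H : H3Category C) (a : H3Label) :
    H.obj a ⟶ H.obj a ⊗ H.obj .one := (ρ_ (H.obj a)).inv

theorem exists_rightUnitor_inv (V : H.Gauge) (Y : H3Label) :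
    ∃ r : ℂ, r ≠ 0 ∧ H.unitInv Y =
      r • V.vert Y .one Y := by
  obtain ⟨r, hr⟩ := V.exists_smul_vert Y.mem_fusion_one (H.unitInv Y)
  refine ⟨r, ?_, hr⟩
  rintro rfl
  rw [zero_smul] at hr
  have : 𝟙 (H.obj Y) = 0 := by
    rw [← Iso.inv_hom_id (ρ_ (H.obj Y))]
    exact (congrArg (· ≫ (ρ_ (H.obj Y)).hom) hr).trans zero_comp
  exact H.id_ne_zero _ this

/-- The zigzag identity, evaluated on the vertex `z → Y ρ`: expanding the cup gives one factor and
closing with the cap gives the other. The scalars `r, s` compare the chosen vertices with the unit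
constraints, since a gauge normalizes these only for `ρ`. -/
theorem IsUnitary.F_one_mul (hV : V.IsUnitary) (hz : z ∈ H3Label.fusion Y .rho)
    (hY : Y ∈ H3Label.fusion z .rho) {r s : ℂ}
    (hr : H.unitInv Y = r • V.vert Y .one Y)
    (hs : H.unitInv z = s • V.vert z .one z) :
    r * (star (V.F Y .rho .rho Y .one z) * (V.F z .rho .rho z .one Y * dRho)) = s := by
  have hR : RightAdm Y .rho .rho Y .one := ⟨by decide, Y.mem_fusion_one⟩
  have hR' : RightAdm z .rho .rho z .one := ⟨by decide, z.mem_fusion_one⟩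
  have hL' : LeftAdm z .rho .rho z Y := ⟨hY, hz⟩
  have hcup : H.tri.cupAt (H.obj Y) =
      ∑ k, (r * star (V.F Y .rho .rho Y .one k)) • V.leftTree Y .rho .rho Y k := by
    have h1 : H.tri.cupAt (H.obj Y) =
        r • (V.rightTree Y .rho .rho Y .one ≫ (α_ _ _ _).inv) := by
      rw [rightTree, V.vert_cup, ← Linear.smul_comp, ← Linear.smul_comp, ← hr]
      exact (Category.assoc _ _ _).symm
    rw [h1, hV.expand_inv hR, Finset.smul_sum]
    simp only [smul_smul]
  -- By Schur's lemma the partially closed left tree is a scalar `S`, which the cap also computes as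
  -- an `F`-entry.
  obtain ⟨S, hS⟩ : ∃ S : ℂ, V.vert Y .rho z ≫ V.vert z .rho Y ▷ H.obj .rho ≫
      H.tri.capAt (H.obj z) = S • 𝟙 (H.obj z) := by
    have := H.simple_obj z
    have := H.isFusion.finite_hom (H.obj z) (H.obj z)
    obtain ⟨S, hS⟩ := endomorphism_simple_eq_smul_id ℂ (V.vert Y .rho z ≫
      V.vert z .rho Y ▷ H.obj .rho ≫ H.tri.capAt (H.obj z))
    exact ⟨S, hS.symm⟩
  have hS' : s * S = V.F z .rho .rho z .one Y * dRho := by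
    have h1 : V.leftTree z .rho .rho z Y ≫ (α_ _ _ _).hom ≫ H.obj z ◁ H.capOne =
        (V.F z .rho .rho z .one Y * (dRho : ℂ)) • V.vert z .one z := by
      rw [reassoc_of% (hV.expand hR' hL'), sum_rightTree_cap]
    have h2 : V.leftTree z .rho .rho z Y ≫ (α_ _ _ _).hom ≫ H.obj z ◁ H.capOne =
        (S * s) • V.vert z .one z := by
      have h3 : V.leftTree z .rho .rho z Y ≫ (α_ _ _ _).hom ≫ H.obj z ◁ H.capOne =
        (V.vert Y .rho z ≫ V.vert z .rho Y ▷ H.obj .rho ≫ H.tri.capAt (H.obj z)) ≫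
          H.unitInv z := by
        rw [leftTree]
        simp only [Category.assoc]
        congr 2
        have : H.tri.capAt (H.obj z) ≫ (ρ_ (H.obj z)).inv =
            (α_ _ _ _).hom ≫ H.obj z ◁ H.tri.cap := by
          rw [TrivalentVertex.capAt]; simp
        exact this.symm
      rw [h3, hS, hs, Linear.smul_comp, Category.id_comp, smul_smul]
    have h4 := congrArg (· ≫ V.dual z .one z) (h2.symm.trans h1)
    simp only [Linear.smul_comp, V.vert_dual z.mem_fusion_one] at h4
    rw [mul_comm]
    exact H.smul_id_injective _ h4
  have h1 : V.vert Y .rho z = (r * star (V.F Y .rho .rho Y .one z) * S) • V.vert Y .rho z := by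
    calc V.vert Y .rho z = V.vert Y .rho z ≫ H.tri.cupAt (H.obj Y) ▷ H.obj .rho ≫
          H.tri.capAt (H.obj Y ⊗ H.obj .rho) := by
          rw [TrivalentVertex.cupAt_whiskerRight_comp_capAt, Category.comp_id]
      _ = ∑ k, (r * star (V.F Y .rho .rho Y .one k)) • (V.vert Y .rho z ≫
            V.vert k .rho Y ▷ H.obj .rho ≫ H.tri.capAt (H.obj k)) ≫ V.vert Y .rho k := by
          rw [hcup, sum_whiskerRight, Preadditive.sum_comp,
            Preadditive.comp_sum]
          refine Finset.sum_congr rfl fun k _ => ?_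
          rw [MonoidalLinear.smul_whiskerRight, Linear.smul_comp, Linear.comp_smul, leftTree,
            comp_whiskerRight, Category.assoc, TrivalentVertex.capAt_naturality]
          simp only [Category.assoc]
      _ = _ := by
          rw [Finset.sum_eq_single z]
          · rw [hS, Linear.smul_comp, Category.id_comp, smul_smul]
          · intro k _ hk
            rw [H.hom_eq_zero hk.symm (V.vert Y .rho z ≫
              V.vert k .rho Y ▷ H.obj .rho ≫ H.tri.capAt (H.obj k))]
            simp
          · simp
  have h2 := congrArg (· ≫ V.dual Y .rho z) h1
  simp only [Linear.smul_comp, V.vert_dual hz] at h2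
  have h3 : (1 : ℂ) = r * star (V.F Y .rho .rho Y .one z) * S :=
    H.smul_id_injective z (by rw [one_smul]; exact h2)
  rw [← hS']
  linear_combination (-s) * h3

/-- Using the zigzag relation in both directions cancels the unit scalars. -/
theorem IsUnitary.normSq_F_one_mul (hV : V.IsUnitary) (hz : z ∈ H3Label.fusion Y .rho)
    (hY : Y ∈ H3Label.fusion z .rho) :
    Complex.normSq (V.F Y .rho .rho Y .one z) * Complex.normSq (V.F z .rho .rho z .one Y) *
      dRho ^ 2 = 1 := by
  obtain ⟨r, hr0, hr⟩ := V.exists_rightUnitor_inv Y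
  obtain ⟨s, hs0, hs⟩ := V.exists_rightUnitor_inv z
  have h1 := hV.F_one_mul hz hY hr hs
  have h2 := hV.F_one_mul hY hz hs hr
  have h3 := Complex.mul_conj (V.F Y .rho .rho Y .one z)
  have h4 := Complex.mul_conj (V.F z .rho .rho z .one Y)
  apply Complex.ofReal_injective
  push_cast
  rw [← h3, ← h4]
  rw [← h1] at h2
  simp only [Complex.star_def] at h2
  apply mul_left_cancel₀ hr0
  linear_combination h2

theorem IsUnitary.sum_normSq (hV : V.IsUnitary) {x y z u j : H3Label}
    (hj : RightAdm x y z u j) : ∑ k, Complex.normSq (V.F x y z u j k) = 1 := by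
  have := hV.row hj (i := j)
  simp only [Complex.star_def, Complex.mul_conj, if_true] at this
  exact_mod_cast this

theorem _root_.H3Label.sum_eq {M : Type*} [AddCommMonoid M] (f : H3Label → M) :
    ∑ k, f k = f .one + f .al + f .alS + f .rho + f .alRho + f .alSRho := by
  have : (Finset.univ : Finset H3Label) = {.one, .al, .alS, .rho, .alRho, .alSRho} := rfl
  rw [this]
  simp [Finset.sum_insert, add_assoc]

theorem _root_.dRho_sq : dRho ^ 2 = 3 * dRho + 1 := by
  have := Real.sq_sqrt (show (0 : ℝ) ≤ 13 by norm_num)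
  unfold dRho
  linear_combination this / 4

end Gauge

end H3Category

theorem inv_dRho_sq : dRho⁻¹ ^ 2 = 1 - 3 * dRho⁻¹ := by
  have h := dRho_sq
  have h0 := dRho_pos.ne'
  field_simp
  linarith

theorem inv_dRho_pos : 0 < dRho⁻¹ := inv_pos.2 dRho_pos

theorem inv_dRho_lt_one : dRho⁻¹ < 1 := by
  nlinarith [inv_dRho_sq, inv_dRho_pos]

/-- By the inequality of arithmetic and geometric means each of `u + p`, `w + q`, `r + s` is at
least `2e`, while the total is `6e`. So equality holds throughout. -/
theorem eq_of_three_products {e u w p q r s : ℝ} (he : 0 < e) (hu : 0 ≤ u) (hw : 0 ≤ w)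
    (hp : 0 ≤ p) (hq : 0 ≤ q) (hr : 0 ≤ r) (hs : 0 ≤ s) (h1 : u + w = 2 * e)
    (h2 : p + r = 2 * e) (h3 : q + s = 2 * e) (hup : u * p = e ^ 2) (hwq : w * q = e ^ 2)
    (hrs : r * s = e ^ 2) : u = e ∧ w = e := by
  have key : ∀ a b : ℝ, 0 ≤ a → 0 ≤ b → a * b = e ^ 2 → 2 * e ≤ a + b := by
    intro a b ha hb hab
    nlinarith [sq_nonneg (a - b), sq_nonneg (a + b - 2 * e)]
  have k1 := key u p hu hp hup
  have k2 := key w q hw hq hwq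
  have k3 := key r s hr hs hrs
  have k4 : u + p = 2 * e := by linarith
  have k5 : (u - e) ^ 2 = 0 := by
    have : p = 2 * e - u := by linarith
    subst this
    linarith
  have k6 : u = e := by
    have := pow_eq_zero_iff (two_ne_zero) |>.1 k5
    linarith
  exact ⟨k6, by linarith⟩

namespace H3Category

variable {C : Type u} [Category.{v} C] [MonoidalCategory C] [Abelian C] [Linear ℂ C]
  [MonoidalPreadditive C] [MonoidalLinear ℂ C] {H : H3Category C}

namespace Gauge

variable {V : H.Gauge}

theorem normSq_F_eq_zero {x y z u j k : H3Label} (h : ¬LeftAdm x y z u k) :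
    Complex.normSq (V.F x y z u j k) = 0 := by
  rw [F_eq_zero (by tauto), map_zero]

/-- The squared moduli are weights on the fusion graph of `ρ`: each row sums to `1`, and opposite
weights multiply to `e ^ 2`. Loops then have weight `e`, and the edges from `1, α, α*` have weight
`1`, so their reverses have weight `e ^ 2`. The six remaining weights form a triangle settled by
`eq_of_three_products`, where `1 - e - e ^ 2 = 2 * e`. -/
theorem IsUnitary.normSq_F_one (hV : V.IsUnitary) :
    Complex.normSq (V.F .rho .rho .rho .rho .one .one) = dRho⁻¹ ^ 2 ∧
      Complex.normSq (V.F .rho .rho .rho .rho .one .rho) = dRho⁻¹ ∧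
      Complex.normSq (V.F .rho .rho .rho .rho .one .alRho) = dRho⁻¹ ∧
      Complex.normSq (V.F .rho .rho .rho .rho .one .alSRho) = dRho⁻¹ := by
  have hd := dRho_pos
  have hd0 := hd.ne'
  set e := dRho⁻¹ with he
  have hde : dRho * e = 1 := mul_inv_cancel₀ hd0
  have he0 : 0 < e := inv_dRho_pos
  have hes : e ^ 2 = 1 - 3 * e := inv_dRho_sq
  have hmul : ∀ Y z : H3Label, z ∈ H3Label.fusion Y .rho → Y ∈ H3Label.fusion z .rho →
      Complex.normSq (V.F Y .rho .rho Y .one z) * Complex.normSq (V.F z .rho .rho z .one Y) =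
        e ^ 2 := by
    intro Y z hz hY
    have := hV.normSq_F_one_mul hz hY
    linear_combination e ^ 2 * this - (Complex.normSq (V.F Y .rho .rho Y .one z) *
      Complex.normSq (V.F z .rho .rho z .one Y)) * (dRho * e + 1) * hde
  have hsum : ∀ Y : H3Label, ∑ k, Complex.normSq (V.F Y .rho .rho Y .one k) = 1 := fun Y =>
    hV.sum_normSq ⟨by decide, Y.mem_fusion_one⟩
  have hself : ∀ Y : H3Label, Y ∈ H3Label.fusion Y .rho →
      Complex.normSq (V.F Y .rho .rho Y .one Y) = e := by
    intro Y hY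
    have := hmul Y Y hY hY
    nlinarith [Complex.normSq_nonneg (V.F Y .rho .rho Y .one Y)]
  have h1 := hsum .one
  have h2 := hsum .al
  have h3 := hsum .alS
  have h4 := hsum .rho
  have h5 := hsum .alRho
  have h6 := hsum .alSRho
  rw [H3Label.sum_eq] at h1 h2 h3 h4 h5 h6
  simp (disch := decide) only [normSq_F_eq_zero, zero_add, add_zero] at h1 h2 h3 h4 h5 h6
  have k1 := hmul .one .rho (by decide) (by decide)
  have k2 := hmul .al .alRho (by decide) (by decide)
  have k3 := hmul .alS .alSRho (by decide) (by decide)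
  rw [h1, one_mul] at k1
  rw [h2, one_mul] at k2
  rw [h3, one_mul] at k3
  have s1 := hself .rho (by decide)
  have s2 := hself .alRho (by decide)
  have s3 := hself .alSRho (by decide)
  have := eq_of_three_products he0 (Complex.normSq_nonneg (V.F .rho .rho .rho .rho .one .alRho))
    (Complex.normSq_nonneg (V.F .rho .rho .rho .rho .one .alSRho))
    (Complex.normSq_nonneg (V.F .alRho .rho .rho .alRho .one .rho))
    (Complex.normSq_nonneg (V.F .alSRho .rho .rho .alSRho .one .rho))
    (Complex.normSq_nonneg (V.F .alRho .rho .rho .alRho .one .alSRho))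
    (Complex.normSq_nonneg (V.F .alSRho .rho .rho .alSRho .one .alRho))
    (by linarith) (by linarith) (by linarith) (hmul _ _ (by decide) (by decide))
    (hmul _ _ (by decide) (by decide)) (hmul _ _ (by decide) (by decide))
  exact ⟨k1, s1, this.1, this.2⟩

/-! ### The moment equations -/

/-- The eigenvalues of the rung on the channels `1, ρ, _αρ, _{α*}ρ`, together with the relations
between them that come from the first three moments. -/
structure RungEigenvalues (V : H.Gauge) (a p q : ℝ) : Prop where
  one : V.vert .rho .rho .one ≫ H.tri.rung = (Real.sqrt dRho : ℂ) • V.vert .rho .rho .one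
  rho : V.vert .rho .rho .rho ≫ H.tri.rung =
    ((Real.sqrt dRho : ℂ) * a) • V.vert .rho .rho .rho
  alRho : V.vert .rho .rho .alRho ≫ H.tri.rung =
    ((Real.sqrt dRho : ℂ) * p) • V.vert .rho .rho .alRho
  alSRho : V.vert .rho .rho .alSRho ≫ H.tri.rung =
    ((Real.sqrt dRho : ℂ) * q) • V.vert .rho .rho .alSRho
  moment_one : dRho⁻¹ + a + p + q = 0
  moment_two : dRho⁻¹ + a ^ 2 + p ^ 2 + q ^ 2 = 1
  moment_three : dRho⁻¹ + a ^ 3 + p ^ 3 + q ^ 3 = a ^ 2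

/-- Capping a rung produces a bigon on one strand, so its value is the eigenvalue on the channel
`1`. -/
theorem cup_rung {h : ℂ} (hh : V.vert .rho .rho .one ≫ H.tri.rung = h • V.vert .rho .rho .one) :
    h = (Real.sqrt dRho : ℂ) := by
  have h1 : V.vert .rho .rho .one ≫ H.tri.rung ≫ H.capOne = (h * dRho) • 𝟙 (H.obj .one) := by
    rw [← Category.assoc, hh, Linear.smul_comp, V.vert_cup, H.cupOne_capOne, smul_smul]
  have h2 : V.vert .rho .rho .one ≫ H.tri.rung ≫ H.capOne =
      ((Real.sqrt dRho : ℂ) * dRho) • 𝟙 (H.obj .one) := by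
    have h3 : H.tri.rung ≫ H.capOne = (H.tri.vertex ≫ H.tri.merge) ▷ H.obj .rho ≫ H.capOne :=
      H.tri.rung_comp_cap
    rw [h3, H.vertex_merge, MonoidalLinear.smul_whiskerRight, id_whiskerRight, Linear.smul_comp,
      Category.id_comp, Linear.comp_smul, V.vert_cup, H.cupOne_capOne, smul_smul]
  exact mul_right_cancel₀ dRho_ne_zero (H.smul_id_injective _ (h1.symm.trans h2))

theorem IsUnitary.exists_rungEigenvalues (hV : V.IsUnitary) :
    ∃ a p q : ℝ, RungEigenvalues V a p q := by
  obtain ⟨h, hh⟩ := V.exists_eigenvalue H.tri.rung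
  obtain ⟨m1, m2, m3, m4⟩ := hV.normSq_F_one
  have hd := dRho_pos
  have hd0 := hd.ne'
  have hb := sqrt_dRho_pos
  have hb2 : Real.sqrt dRho ^ 2 = dRho := Real.sq_sqrt hd.le
  set b := Real.sqrt dRho with hb_def
  have hR : ∀ k, LeftAdm .rho .rho .rho .rho k →
      V.F .rho .rho .rho .rho .rho k = h k * V.F .rho .rho .rho .rho .one k := fun k hk =>
    hV.F_rho_eq hk (hh k hk.1)
  have hR' : ∀ k, LeftAdm .rho .rho .rho .rho k →
      star (V.F .rho .rho .rho .rho .rho k) = h k * star (V.F .rho .rho .rho .rho .one k) :=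
    fun k hk => hV.star_F_rho_eq hh hk
  have hne : ∀ k, LeftAdm .rho .rho .rho .rho k → V.F .rho .rho .rho .rho .one k ≠ 0 := by
    intro k hk h0
    have hi := inv_dRho_pos
    revert hk
    cases k <;> intro hk
    · rw [h0, map_zero] at m1; nlinarith
    · exact absurd hk (by decide)
    · exact absurd hk (by decide)
    · rw [h0, map_zero] at m2; linarith
    · rw [h0, map_zero] at m3; linarith
    · rw [h0, map_zero] at m4; linarith
  -- Conjugating `hR` and comparing with `hR'` shows `h k` to be real, because the entry in the row
  -- `1` does not vanish.
  have hreal : ∀ k, LeftAdm .rho .rho .rho .rho k → ∃ r : ℝ, h k = b * r := by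
    intro k hk
    have h1 := hR' k hk
    rw [hR k hk, star_mul'] at h1
    have h2 := mul_right_cancel₀ (star_ne_zero.2 (hne k hk)) h1
    obtain ⟨r, hr⟩ := Complex.conj_eq_iff_real.1 h2
    refine ⟨r / b, ?_⟩
    rw [hr, Complex.ofReal_div]
    rw [← mul_div_assoc, mul_div_cancel_left₀ _ sqrt_dRho_ne_zero]
  have hone : h .one = b := cup_rung (hh .one (by decide))
  obtain ⟨a, ha⟩ := hreal .rho (by decide)
  obtain ⟨p, hp⟩ := hreal .alRho (by decide)
  obtain ⟨q, hq⟩ := hreal .alSRho (by decide)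
  have r1 := hV.row (x := .rho) (y := .rho) (z := .rho) (u := .rho) (i := .one) (j := .rho)
    (by decide)
  have r2 := hV.row (x := .rho) (y := .rho) (z := .rho) (u := .rho) (i := .rho) (j := .rho)
    (by decide)
  have hκ : ∀ k ∈ H3Label.fusion .rho .rho,
      V.vert .rho .rho k ≫ H.tri.rungAt (V.vert .rho .rho .rho) = h k • V.vert .rho .rho k := by
    intro k hk
    rw [V.vert_vertex]
    exact hh k hk
  have r3 := hV.rung_exchange (u := .rho) (by decide) (by decide) hκ hh
    (j := .rho) (by decide)
  have r4 := hV.F_rho_self (u := .rho) (by decide) (by decide) (hκ .rho (by decide))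
  have z1 : ∀ j, V.F .rho .rho .rho .rho j .al = 0 := fun j => F_eq_zero fun h' =>
    absurd h'.2 (by decide)
  have z2 : ∀ j, V.F .rho .rho .rho .rho j .alS = 0 := fun j => F_eq_zero fun h' =>
    absurd h'.2 (by decide)
  rw [H3Label.sum_eq] at r1 r2 r3
  simp only [z1, z2, zero_mul, add_zero] at r1 r2 r3
  rw [hR' .one (by decide), hR' .rho (by decide), hR' .alRho (by decide),
    hR' .alSRho (by decide)] at r1 r2 r3
  rw [hR .one (by decide), hR .rho (by decide), hR .alRho (by decide),
    hR .alSRho (by decide)] at r2 r3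
  rw [hR .rho (by decide)] at r4
  have n1 := Complex.mul_conj (V.F .rho .rho .rho .rho .one .one)
  have n2 := Complex.mul_conj (V.F .rho .rho .rho .rho .one .rho)
  have n3 := Complex.mul_conj (V.F .rho .rho .rho .rho .one .alRho)
  have n4 := Complex.mul_conj (V.F .rho .rho .rho .rho .one .alSRho)
  rw [m1] at n1
  rw [m2] at n2
  rw [m3] at n3
  rw [m4] at n4
  simp only [Complex.star_def] at r1 r2 r3
  rw [hone, ha, hp, hq] at r1 r2 r3
  rw [ha] at r4
  simp only [if_neg (show ¬(H3Label.one = H3Label.rho) by decide), if_true] at r1 r2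
  set e := dRho⁻¹ with he
  have hde : dRho * e = 1 := mul_inv_cancel₀ hd0
  -- With the weights `e ^ 2, e, e, e` the moments of `h` are: orthogonality of the rows `1` and
  -- `ρ`, the norm of the row `ρ`, and the rung exchange at `ρ` with `F_ρρ √d = h ρ`.
  have s1 : (b : ℂ) * e ^ 2 + b * a * e + b * p * e + b * q * e = 0 := by
    rw [← r1]; push_cast at n1 n2 n3 n4
    linear_combination (-(b : ℂ)) * n1 - b * a * n2 - b * p * n3 - b * q * n4
  have s2 : (b : ℂ) ^ 2 * e ^ 2 + (b * a) ^ 2 * e + (b * p) ^ 2 * e + (b * q) ^ 2 * e = 1 := by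
    rw [← r2]; push_cast at n1 n2 n3 n4
    linear_combination (-(b : ℂ) ^ 2) * n1 - (b * a) ^ 2 * n2 - (b * p) ^ 2 * n3 -
      (b * q) ^ 2 * n4
  have s3 : ((b : ℂ) ^ 3 * e ^ 2 + (b * a) ^ 3 * e + (b * p) ^ 3 * e + (b * q) ^ 3 * e) * b =
      (b * a) ^ 2 := by
    push_cast at n1 n2 n3 n4
    linear_combination (b : ℂ) * r3 + b * a * r4 - b * ((b : ℂ) ^ 3 * n1 + (b * a) ^ 3 * n2 +
      (b * p) ^ 3 * n3 + (b * q) ^ 3 * n4)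
  norm_cast at s1 s2 s3
  have hbe : b ^ 2 * e = 1 := by rw [hb2, hde]
  have hbe0 : b * e ≠ 0 := by
    intro h0
    have : b * (b * e) = 1 := by rw [← hbe]; ring
    rw [h0] at this
    simp at this
  refine ⟨a, p, q, ⟨?_, ?_, ?_, ?_, ?_, ?_, ?_⟩⟩
  · rw [← hone]; exact hh _ (by decide)
  · rw [← ha]; exact hh _ (by decide)
  · rw [← hp]; exact hh _ (by decide)
  · rw [← hq]; exact hh _ (by decide)
  · apply mul_left_cancel₀ hbe0
    linear_combination s1
  · linear_combination s2 - (e + a ^ 2 + p ^ 2 + q ^ 2) * hbe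
  · linear_combination e * s3 + a ^ 2 * hbe - (e + a ^ 3 + p ^ 3 + q ^ 3) * (b ^ 2 * e + 1) * hbe

theorem RungEigenvalues.cases {a p q : ℝ} (h : RungEigenvalues V a p q) :
    a = 0 ∨ a = (2 - dRho⁻¹) / 3 ∨ a = -(1 + 2 * dRho⁻¹) / 3 := by
  have h1 := h.moment_one
  have h2 := h.moment_two
  have h3 := h.moment_three
  have he := inv_dRho_sq
  set e := dRho⁻¹
  have hq : q = -e - a - p := by linarith
  subst hq
  -- Once `q` is eliminated, the second moment removes `p` from the third, which leaves this cubic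
  -- in `a`.
  have : a * ((a - (2 - e) / 3) * (a - -(1 + 2 * e) / 3)) = 0 := by
    linear_combination (1 / 3 : ℝ) * h3 + (a / 2 + e / 2) * h2 + (2 * a / 9 - a / 2 - e / 6) * he
  rcases mul_eq_zero.1 this with h | h
  · exact Or.inl h
  · rcases mul_eq_zero.1 h with h | h
    · exact Or.inr (Or.inl (by linarith))
    · exact Or.inr (Or.inr (by linarith))

end Gauge

end H3Category

/-! ### Excluding `a = 0`: translation by `α` and rotated trees -/

namespace TrivalentVertex

variable {C : Type u} [Category.{v} C] [MonoidalCategory C] {X : C} (T : TrivalentVertex X)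

theorem rungAt_comp_whiskerRight {Y A : C} {v : Y ⟶ Y ⊗ X} {f : Y ⟶ A ⊗ X} :
    T.rungAt v ≫ f ▷ X ≫ (α_ A X X).hom =
      (v ≫ f ▷ X ≫ (α_ A X X).hom) ▷ X ≫ (α_ A (X ⊗ X) X).hom ≫ A ◁ (α_ X X X).hom ≫
        A ◁ X ◁ T.merge := by
  have h := whisker_exchange f T.merge
  calc _ = 𝟙 (Y ⊗ X) ⊗≫ v ▷ X ⊗≫ (Y ◁ T.merge ≫ f ▷ X) ⊗≫ 𝟙 (A ⊗ (X ⊗ X)) := by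
        rw [rungAt]; monoidal
    _ = _ := by rw [h]; monoidal

/-- The rotation of `f : B ⟶ Z ⊗ X` by which the lower leg becomes the left upper leg and the
right upper leg becomes the lower leg, where the lower leg is bent up by `c : 𝟙_ C ⟶ A ⊗ B`. -/
def bend {A B Z : C} (c : 𝟙_ C ⟶ A ⊗ B) (f : B ⟶ Z ⊗ X) : X ⟶ A ⊗ Z :=
  (λ_ X).inv ≫ c ▷ X ≫ (α_ A B X).hom ≫ A ◁ (f ▷ X ≫ T.capAt Z)

theorem bend_comp_whiskerRight {A B Z W : C} (c : 𝟙_ C ⟶ A ⊗ B) (f : B ⟶ Z ⊗ X) (g : Z ⟶ W) :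
    T.bend c (f ≫ g ▷ X) = T.bend c f ≫ A ◁ g := by
  rw [bend, comp_whiskerRight, Category.assoc, capAt_naturality, bend]
  simp

theorem cup_comp_bend {A B Z : C} (c : 𝟙_ C ⟶ A ⊗ B) (f : B ⟶ Z ⊗ X) :
    T.cup ≫ T.bend c f ▷ X ≫ (α_ A Z X).hom = c ≫ A ◁ f := by
  have h := whisker_exchange c T.cup
  have h' := whisker_exchange f T.cup
  calc _ = 𝟙 (𝟙_ C) ⊗≫ (𝟙_ C ◁ T.cup ≫ c ▷ (X ⊗ X)) ⊗≫ A ◁ f ▷ X ▷ X ⊗≫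
          A ◁ (T.capAt Z) ▷ X ⊗≫ 𝟙 (A ⊗ (Z ⊗ X)) := by
        rw [bend]; monoidal
    _ = c ⊗≫ A ◁ (B ◁ T.cup ≫ f ▷ (X ⊗ X)) ⊗≫ A ◁ (T.capAt Z) ▷ X ⊗≫
          𝟙 (A ⊗ (Z ⊗ X)) := by
        rw [h]; monoidal
    _ = c ⊗≫ A ◁ f ⊗≫ A ◁ (T.cupAt (Z ⊗ X) ≫ T.capAt Z ▷ X) ⊗≫
          𝟙 (A ⊗ (Z ⊗ X)) := by
        rw [h', cupAt]; monoidal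
    _ = _ := by rw [cupAt_comp_capAt_whiskerRight]; monoidal

theorem bend_right {A B Z W : C} (c : 𝟙_ C ⟶ A ⊗ B) (f : B ⟶ Z ⊗ W) (g : W ⟶ Z ⊗ X) :
    T.bend c (f ≫ Z ◁ g ≫ (α_ Z Z X).inv) =
      (λ_ X).inv ≫ (c ≫ A ◁ f ≫ (α_ A Z W).inv) ▷ X ≫ (α_ (A ⊗ Z) W X).hom ≫
        (A ⊗ Z) ◁ (g ▷ X ≫ T.capAt Z) ≫ (α_ A Z Z).hom := by
  rw [bend, capAt, capAt]; monoidal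

theorem comp_whiskerRight_exchange {U B P Q Z W : C} (e : U ⟶ P ⊗ B) (w : P ⟶ Q)
    (g : B ⊗ Z ⟶ W) :
    (e ≫ w ▷ B) ▷ Z ≫ (α_ Q B Z).hom ≫ Q ◁ g =
      (e ▷ Z ≫ (α_ P B Z).hom ≫ P ◁ g) ≫ w ▷ W := by
  have h := whisker_exchange w g
  calc _ = e ▷ Z ⊗≫ (w ▷ (B ⊗ Z) ≫ Q ◁ g) := by monoidal
    _ = _ := by rw [← h]; monoidal

end TrivalentVertex

namespace H3Category

variable {C : Type u} [Category.{v} C] [MonoidalCategory C] [Abelian C] [Linear ℂ C]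
  [MonoidalPreadditive C] [MonoidalLinear ℂ C] {H : H3Category C}

namespace Gauge

variable {V : H.Gauge}

/-- A basis vertex `c → x y` turns an associator with unique admissible labels into a phase. -/
theorem IsUnitary.exists_phase (hV : V.IsUnitary) {x y z u k j : H3Label}
    (hk : LeftAdm x y z u k) (hj : RightAdm x y z u j) (hu : ∀ i, RightAdm x y z u i → i = j) :
    ∃ θ : ℂ, Complex.normSq θ = 1 ∧
      V.leftTree x y z u k ≫ (α_ _ _ _).hom = θ • V.rightTree x y z u j := by
  refine ⟨V.F x y z u j k, ?_, ?_⟩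
  · have := hV.col hk (l := k)
    rw [Finset.sum_eq_single j (fun i _ hi => by rw [F_eq_zero (fun h => hi (hu i h.1))]; simp)
      (by simp)] at this
    rw [Complex.star_def, mul_comm, Complex.mul_conj, if_pos rfl] at this
    exact_mod_cast this
  · rw [hV.expand hj hk]
    exact Finset.sum_eq_single j
      (fun i _ hi => by rw [F_eq_zero (fun h => hi (hu i h.1))]; simp) (by simp)

theorem rightTree_ne_zero {x y z u j : H3Label} (hj : RightAdm x y z u j) :
    V.rightTree x y z u j ≠ 0 := by
  intro h
  have := V.rightTree_rightDual hj
  rw [h, zero_comp] at this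
  exact H.id_ne_zero _ this.symm

/-- The rung on the strand `_αρ = α ρ` is, up to a phase, the rung on `ρ` next to a strand `α`. -/
theorem IsUnitary.exists_alpha_rung (hV : V.IsUnitary) :
    ∃ θ : ℂ, Complex.normSq θ = 1 ∧ ∀ (k k' : H3Label) (h κ : ℂ),
      LeftAdm .al .rho .rho k .alRho → RightAdm .al .rho .rho k k' →
      (∀ i, RightAdm .al .rho .rho k i → i = k') →
      V.vert .rho .rho k' ≫ H.tri.rung = h • V.vert .rho .rho k' →
      V.vert .alRho .rho k ≫ H.tri.rungAt (V.vert .alRho .rho .alRho) =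
        κ • V.vert .alRho .rho k → κ = θ * h := by
  obtain ⟨θ, hθ, hθ'⟩ := hV.exists_phase (x := .al) (y := .rho) (z := .rho) (u := .alRho)
    (k := .alRho) (j := .rho) (by decide) (by decide) (by decide)
  refine ⟨θ, hθ, ?_⟩
  intro k k' h κ hk hk' hu hh hκ
  obtain ⟨ψ, hψ, hψ'⟩ := hV.exists_phase hk hk' hu
  -- Splitting `_αρ` into `α` and `ρ` moves the rung onto the strand `ρ`; the phase `θ` arises from
  -- reassociating the emitting vertex.
  have h1 : H.tri.rungAt (V.vert .alRho .rho .alRho) ≫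
      V.vert .al .rho .alRho ▷ H.obj .rho ≫ (α_ _ _ _).hom =
      θ • (V.vert .al .rho .alRho ▷ H.obj .rho ≫ (α_ _ _ _).hom ≫ H.obj .al ◁ H.tri.rung) := by
    rw [TrivalentVertex.rungAt_comp_whiskerRight]
    have h2 : V.vert .alRho .rho .alRho ≫ V.vert .al .rho .alRho ▷ H.obj .rho ≫
        (α_ (H.obj .al) (H.obj .rho) (H.obj .rho)).hom =
        θ • (V.vert .al .rho .alRho ≫ H.obj .al ◁ H.tri.vertex) := by
      rw [← Category.assoc]
      refine hθ'.trans ?_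
      rw [rightTree, V.vert_vertex]
    rw [h2, MonoidalLinear.smul_whiskerRight, Linear.smul_comp, TrivalentVertex.rung]
    congr 1
    monoidal
  have h3 : V.leftTree .al .rho .rho k .alRho ≫ (α_ _ _ _).hom ≠ 0 := by
    rw [hψ']
    intro h0
    rcases smul_eq_zero.1 h0 with h0 | h0
    · rw [h0, map_zero] at hψ; exact zero_ne_one hψ
    · exact rightTree_ne_zero hk' h0
  have h4 : κ • (V.leftTree .al .rho .rho k .alRho ≫ (α_ _ _ _).hom) =
      (θ * h) • (V.leftTree .al .rho .rho k .alRho ≫ (α_ _ _ _).hom) := by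
    calc _ = (κ • V.vert .alRho .rho k) ≫ V.vert .al .rho .alRho ▷ H.obj .rho ≫
          (α_ _ _ _).hom := by
          rw [leftTree, Linear.smul_comp, Category.assoc]
      _ = θ • ((V.leftTree .al .rho .rho k .alRho ≫ (α_ _ _ _).hom) ≫
          H.obj .al ◁ H.tri.rung) := by
          rw [← hκ, Category.assoc, h1, Linear.comp_smul, leftTree]
          simp only [Category.assoc]
      _ = _ := by
          rw [hψ', Linear.smul_comp, rightTree_eigenvalue hh, smul_smul, smul_smul, smul_smul]
          congr 1; ring
  exact smul_left_injective ℂ h3 h4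

/-- `rung_exchange` is paired with the column `Y` of `F`; orthonormality of columns leaves only the
term `k = Y` of the inner sum. -/
theorem IsUnitary.rung_exchange_col (hV : V.IsUnitary) {Y u : H3Label}
    (hY : Y ∈ H3Label.fusion Y .rho)
    (hu : u ∈ H3Label.fusion Y .rho) {κ h : H3Label → ℂ}
    (hκ : ∀ k ∈ H3Label.fusion Y .rho,
      V.vert Y .rho k ≫ H.tri.rungAt (V.vert Y .rho Y) = κ k • V.vert Y .rho k)
    (hh : ∀ j ∈ H3Label.fusion .rho .rho,
      V.vert .rho .rho j ≫ H.tri.rung = h j • V.vert .rho .rho j) :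
    ∑ j, h j * Complex.normSq (V.F Y .rho .rho u j Y) =
      κ Y * star (V.F Y .rho .rho u .rho Y) := by
  have hk : LeftAdm Y .rho .rho u Y := ⟨hY, hu⟩
  calc _ = ∑ j, star (V.F Y .rho .rho u j Y) *
        ∑ k, V.F Y .rho .rho u j k * κ k * star (V.F Y .rho .rho u .rho k) := by
        refine Finset.sum_congr rfl fun j _ => ?_
        by_cases hj : RightAdm Y .rho .rho u j
        · rw [hV.rung_exchange hY hu hκ hh hj, ← Complex.mul_conj, Complex.star_def]
          ring
        · rw [F_eq_zero (by tauto)]; simp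
    _ = ∑ k, (∑ j, star (V.F Y .rho .rho u j Y) * V.F Y .rho .rho u j k) *
          (κ k * star (V.F Y .rho .rho u .rho k)) := by
        simp only [Finset.mul_sum, Finset.sum_mul]
        rw [Finset.sum_comm]
        refine Finset.sum_congr rfl fun k _ => Finset.sum_congr rfl fun j _ => ?_
        ring
    _ = _ := by
        simp only [hV.col hk, ite_mul, one_mul, zero_mul, Finset.sum_ite_eq, Finset.mem_univ,
          if_true]

/-- The cup of the self-dual object `_αρ`. -/
noncomputable def cupAlRho (V : H.Gauge) : 𝟙_ C ⟶ H.obj .alRho ⊗ H.obj .alRho :=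
  V.vert .alRho .alRho .one

/-- Bending is undone by a cup (`cup_comp_bend`), and a retraction of `f` then recovers the nonzero
cup of `_αρ`. -/
theorem bend_ne_zero {Z : C} {f : H.obj .alRho ⟶ Z ⊗ H.obj .rho} (hf : f ≠ 0) :
    H.tri.bend V.cupAlRho f ≠ 0 := by
  intro h
  have h1 := H.tri.cup_comp_bend V.cupAlRho f
  obtain ⟨g, hg⟩ := H.exists_retraction f hf
  have h2 : V.cupAlRho ≫ H.obj .alRho ◁ f ≫ H.obj .alRho ◁ g = V.cupAlRho := by
    rw [← MonoidalCategory.whiskerLeft_comp, hg]; simp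
  rw [← Category.assoc, ← h1, h] at h2
  simp only [MonoidalPreadditive.zero_whiskerRight, zero_comp, comp_zero] at h2
  exact V.ne_zero .alRho .alRho .one (by decide) h2.symm

theorem bend_smul (r : ℂ) {Z : C} (f : H.obj .alRho ⟶ Z ⊗ H.obj .rho) :
    H.tri.bend V.cupAlRho (r • f) = r • H.tri.bend V.cupAlRho f := by
  simp only [TrivalentVertex.bend, MonoidalLinear.smul_whiskerRight, Linear.smul_comp,
    MonoidalLinear.whiskerLeft_smul, Linear.comp_smul]

theorem bend_sum {Z : C} (f : H3Label → (H.obj .alRho ⟶ Z ⊗ H.obj .rho)) :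
    H.tri.bend V.cupAlRho (∑ k, f k) = ∑ k, H.tri.bend V.cupAlRho (f k) := by
  simp only [TrivalentVertex.bend, sum_whiskerRight, Preadditive.sum_comp,
    whiskerLeft_sum, Preadditive.comp_sum]

theorem exists_bend_left (k : H3Label) : ∃ r : ℂ,
    H.tri.bend V.cupAlRho (V.leftTree .rho .rho .rho .alRho k) =
      r • V.rightTree .alRho .rho .rho .rho k := by
  rw [leftTree, TrivalentVertex.bend_comp_whiskerRight]
  by_cases hk : H3Label.rho ∈ H3Label.fusion .alRho k
  · obtain ⟨r, hr⟩ := V.exists_smul_vert hk (H.tri.bend V.cupAlRho (V.vert k .rho .alRho))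
    exact ⟨r, by rw [hr, Linear.smul_comp, rightTree]⟩
  · exact ⟨0, by rw [H.hom_tensor_eq_zero hk (H.tri.bend V.cupAlRho (V.vert k .rho .alRho))]; simp⟩

/-- The bent lower part is a map from `1` to `(_αρ ρ) j`. It factors through the channel `j` of `_αρ
ρ`, the only label that can pair with `j` to `1`; the rest lies in a one-dimensional space. -/
theorem exists_bend_right {j : H3Label} (hj : ∀ k, H3Label.one ∈ H3Label.fusion k j → k = j)
    (hj' : H3Label.rho ∈ H3Label.fusion j .rho) : ∃ r : ℂ,
    H.tri.bend V.cupAlRho (V.rightTree .rho .rho .rho .alRho j ≫ (α_ _ _ _).inv) =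
      r • (V.leftTree .alRho .rho .rho .rho j ≫ (α_ _ _ _).hom) := by
  rw [rightTree, Category.assoc, TrivalentVertex.bend_right]
  obtain ⟨e, he⟩ : ∃ e : H.obj .one ⟶ (H.obj .alRho ⊗ H.obj .rho) ⊗ H.obj j,
    e = V.cupAlRho ≫ H.obj .alRho ◁ V.vert .rho j .alRho ≫ (α_ _ _ _).inv := ⟨_, rfl⟩
  have h1 : e = (e ≫ V.dual .alRho .rho j ▷ H.obj j) ≫ V.vert .alRho .rho j ▷ H.obj j := by
    conv_lhs => rw [← Category.comp_id e, ← id_whiskerRight, ← V.sum_dual_vert,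
      sum_whiskerRight, Preadditive.comp_sum]
    by_cases hm : j ∈ H3Label.fusion .alRho .rho
    · rw [Finset.sum_eq_single_of_mem j hm]
      · rw [comp_whiskerRight, Category.assoc]
      · intro k _ hk
        rw [comp_whiskerRight, ← Category.assoc,
          H.hom_tensor_eq_zero (fun h => hk (hj k h)) (e ≫ _), zero_comp]
    · rw [dual, dif_neg hm]
      simp only [MonoidalPreadditive.zero_whiskerRight, zero_comp, comp_zero]
      refine Finset.sum_eq_zero fun k hk => ?_
      have hkj : k ≠ j := by rintro rfl; exact hm hk
      rw [comp_whiskerRight, ← Category.assoc,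
          H.hom_tensor_eq_zero (fun h => hkj (hj k h)) (e ≫ _), zero_comp]
  obtain ⟨e', he'⟩ : ∃ e' : 𝟙_ C ⟶ H.obj j ⊗ H.obj j, e' = e ≫ V.dual .alRho .rho j ▷ H.obj j :=
    ⟨_, rfl⟩
  have h2 : V.cupAlRho ≫ H.obj .alRho ◁ V.vert .rho j .alRho ≫ (α_ _ _ _).inv =
      e' ≫ V.vert .alRho .rho j ▷ H.obj j := by
    rw [he']
    exact he.symm.trans h1
  obtain ⟨r, hr⟩ := V.exists_smul_vert hj' ((λ_ (H.obj .rho)).inv ≫ e' ▷ H.obj .rho ≫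
    (α_ _ _ _).hom ≫ H.obj j ◁ (V.vert .rho .rho j ▷ H.obj .rho ≫ H.tri.capAt (H.obj .rho)))
  refine ⟨r, ?_⟩
  rw [h2, leftTree, ← Linear.smul_comp, ← Linear.smul_comp, ← hr]
  have h3 := TrivalentVertex.comp_whiskerRight_exchange e' (V.vert .alRho .rho j)
    (V.vert .rho .rho j ▷ H.obj .rho ≫ H.tri.capAt (H.obj .rho))
  rw [reassoc_of% h3]
  simp only [Category.assoc]

end Gauge

end H3Category

namespace H3Category

variable {C : Type u} [Category.{v} C] [MonoidalCategory C] [Abelian C] [Linear ℂ C]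
  [MonoidalPreadditive C] [MonoidalLinear ℂ C] {H : H3Category C}

namespace Gauge

variable {V : H.Gauge}

/-- Rotating trees by one leg relates two `F`-matrices up to a scaling of the trees. -/
theorem IsUnitary.exists_rotation (hV : V.IsUnitary) : ∃ φ ψ : H3Label → ℂ,
    φ .alRho ≠ 0 ∧ ψ .alRho ≠ 0 ∧ ∀ j k,
      ψ j * V.F .alRho .rho .rho .rho k j = star (V.F .rho .rho .rho .alRho j k) * φ k := by
  have hA : ∀ k, ∃ r : ℂ, H.tri.bend V.cupAlRho (V.leftTree .rho .rho .rho .alRho k) =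
      r • V.rightTree .alRho .rho .rho .rho k := fun k => exists_bend_left k
  have hB : ∀ j, ∃ r : ℂ, RightAdm .rho .rho .rho .alRho j →
      H.tri.bend V.cupAlRho (V.rightTree .rho .rho .rho .alRho j ≫ (α_ _ _ _).inv) =
      r • (V.leftTree .alRho .rho .rho .rho j ≫ (α_ _ _ _).hom) := by
    intro j
    by_cases hj : RightAdm .rho .rho .rho .alRho j
    · have h1 : ∀ k, H3Label.one ∈ H3Label.fusion k j → k = j := by
        revert hj; cases j <;> decide
      have h2 : H3Label.rho ∈ H3Label.fusion j .rho := by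
        revert hj; cases j <;> decide
      obtain ⟨r, hr⟩ := exists_bend_right (V := V) h1 h2
      exact ⟨r, fun _ => hr⟩
    · exact ⟨0, fun h => absurd h hj⟩
  choose φ hφ using hA
  choose ψ hψ using hB
  have hL : LeftAdm .rho .rho .rho .alRho .alRho := by decide
  have hR : RightAdm .rho .rho .rho .alRho .alRho := by decide
  refine ⟨φ, ψ, ?_, ?_, ?_⟩
  · intro h0
    have h1 := hφ .alRho
    rw [h0, zero_smul] at h1
    refine bend_ne_zero ?_ h1
    intro h2
    have h3 := V.leftTree_leftDual hL
    rw [h2, zero_comp] at h3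
    exact H.id_ne_zero _ h3.symm
  · intro h0
    have h1 := hψ .alRho hR
    rw [h0, zero_smul] at h1
    refine bend_ne_zero ?_ h1
    intro h2
    have h3 := V.rightTree_rightDual hR
    have h4 : V.rightTree .rho .rho .rho .alRho .alRho = 0 := by
      rw [← cancel_mono (α_ _ _ _).inv, h2, zero_comp]
    rw [h4, zero_comp] at h3
    exact H.id_ne_zero _ h3.symm
  · intro j k
    by_cases hj : RightAdm .rho .rho .rho .alRho j
    · by_cases hk : RightAdm .alRho .rho .rho .rho k
      · have hj' : LeftAdm .alRho .rho .rho .rho j := by revert hj; cases j <;> decide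
        have h1 := congrArg (H.tri.bend V.cupAlRho) (hV.expand_inv hj)
        rw [bend_sum, hψ j hj, hV.expand hk hj', Finset.smul_sum] at h1
        simp only [bend_smul, hφ, smul_smul] at h1
        exact V.rightTree_coeff h1 hk
      · have hk' : ¬ LeftAdm .rho .rho .rho .alRho k := by revert hk; cases k <;> decide
        rw [F_eq_zero (by tauto), F_eq_zero (by tauto)]; simp
    · have hj' : ¬ LeftAdm .alRho .rho .rho .rho j := by revert hj; cases j <;> decide
      rw [F_eq_zero (by tauto), F_eq_zero (by tauto)]; simp

/-- Rotation gives `N D_ψ = D_φ M*` with `M, N` unitary on their admissible labels and `D_φ, D_ψ`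
diagonal. Multiplying this by its adjoint gives `N |D_ψ|² = |D_φ|² N`. Where an entry of `N` is
nonzero, the two scalings therefore have equal modulus and drop out. -/
theorem IsUnitary.normSq_rotation (hV : V.IsUnitary) :
    Complex.normSq (V.F .alRho .rho .rho .rho .alRho .alRho) =
      Complex.normSq (V.F .rho .rho .rho .alRho .alRho .alRho) := by
  obtain ⟨φ, ψ, hφ, hψ, h⟩ := hV.exists_rotation
  set M := V.F .rho .rho .rho .alRho with hM
  set N := V.F .alRho .rho .rho .rho with hN
  have hL : LeftAdm .rho .rho .rho .alRho .alRho := by decide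
  have hL' : LeftAdm .alRho .rho .rho .rho .alRho := by decide
  have key : N .alRho .alRho * (ψ .alRho * star (ψ .alRho)) =
      φ .alRho * star (φ .alRho) * N .alRho .alRho := by
    have h1 : ∀ i, ∑ l, N .alRho l * (ψ l * star (ψ l)) * star (N i l) =
        if i = .alRho then φ .alRho * star (φ .alRho) else 0 := by
      intro i
      have : ∀ l, N .alRho l * (ψ l * star (ψ l)) * star (N i l) =
          φ .alRho * star (φ i) * (star (M l .alRho) * M l i) := by
        intro l
        have e1 := h l .alRho
        have e2 := congrArg star (h l i)
        simp only [star_mul', star_star] at e2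
        linear_combination (star (ψ l) * star (N i l)) * e1 + (star (M l .alRho) * φ .alRho) * e2
      simp only [this, ← Finset.mul_sum]
      rw [hV.col hL]
      by_cases hi : i = .alRho
      · rw [hi]; simp
      · rw [if_neg (Ne.symm hi), if_neg hi, mul_zero]
    have h2 : ∑ i, (∑ l, N .alRho l * (ψ l * star (ψ l)) * star (N i l)) * N i .alRho =
        N .alRho .alRho * (ψ .alRho * star (ψ .alRho)) := by
      simp only [Finset.sum_mul]
      rw [Finset.sum_comm]
      have : ∀ l, ∑ i, N .alRho l * (ψ l * star (ψ l)) * star (N i l) * N i .alRho =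
          N .alRho l * (ψ l * star (ψ l)) * if .alRho = l then 1 else 0 := by
        intro l
        have h3 := congrArg star (hV.col hL' (l := l))
        rw [star_sum] at h3
        rw [show (if H3Label.alRho = l then (1 : ℂ) else 0) =
          star (if H3Label.alRho = l then (1 : ℂ) else 0) by split_ifs <;> simp, ← h3,
          Finset.mul_sum]
        refine Finset.sum_congr rfl fun i _ => ?_
        rw [star_mul', star_star]
        ring
      simp only [this, mul_ite, mul_one, mul_zero, Finset.sum_ite_eq, Finset.mem_univ, if_true]
    rw [← h2]
    simp only [h1, ite_mul, zero_mul, Finset.sum_ite_eq', Finset.mem_univ, if_true]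
  have h1 := congrArg Complex.normSq (h .alRho .alRho)
  simp only [map_mul, Complex.star_def, Complex.normSq_conj] at h1
  simp only [Complex.star_def, Complex.mul_conj] at key
  have p1 := Complex.normSq_pos.2 hφ
  have p2 := Complex.normSq_pos.2 hψ
  by_cases h0 : N .alRho .alRho = 0
  · rw [h0, map_zero, mul_zero] at h1
    rw [h0, map_zero]
    rcases mul_eq_zero.1 h1.symm with h2 | h2
    · exact h2.symm
    · exact absurd h2 p1.ne'
  · rw [mul_comm (N _ _)] at key
    have h2 := Complex.ofReal_injective (mul_right_cancel₀ h0 key)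
    rw [h2, mul_comm] at h1
    exact mul_right_cancel₀ p1.ne' h1

/-- Here `A` and `x` stand for `|M_{αρ,ρ}|²` and `|M_{αρ,αρ}|²` with `M = F_{αρ}^{ρρρ}`. The two
formulas for `x` make `q` a rational function of `e`; its quadratic equation then becomes a
polynomial in `e` with positive coefficients that vanishes. -/
theorem no_zero_solution {e p q A x : ℝ} (he : e ^ 2 = 1 - 3 * e) (he0 : 0 < e)
    (h1 : e + p + q = 0) (h2 : e + p ^ 2 + q ^ 2 = 1)
    (hA : A * (p - q) = -q * (1 - p ^ 2)) (hx : x * (p - q) = -q * (1 - q ^ 2))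
    (hxA : x * A * (p - q) ^ 2 = p ^ 2 * (1 + q) ^ 2 * A) : False := by
  have hpq : p * q = -e := by
    have : p = -e - q := by linarith
    subst this
    nlinarith
  have hp : p = -e - q := by linarith
  have hq2 : q ^ 2 = e - e * q := by subst hp; linarith
  have hp2 : p ^ 2 = e - e * p := by nlinarith
  have hq0 : q ≠ 0 := by rintro rfl; simp at hpq; linarith
  have hp1 : 1 - p ^ 2 ≠ 0 := by
    intro h
    have hq : q ^ 2 = -e := by linarith
    have := sq_nonneg q
    linarith
  have hA0 : A ≠ 0 := by
    rintro rfl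
    rw [zero_mul] at hA
    rcases mul_eq_zero.1 hA.symm with h | h
    · exact hq0 (by linarith)
    · exact hp1 h
  have hx2 : x * (p - q) ^ 2 = p ^ 2 * (1 + q) ^ 2 := by
    apply mul_right_cancel₀ hA0
    linear_combination hxA
  have hq1 : 1 + q ≠ 0 := by
    intro h
    have : q = -1 := by linarith
    subst this
    nlinarith
  have h3 : -q * (1 - q) * (p - q) = p ^ 2 * (1 + q) := by
    apply mul_right_cancel₀ hq1
    linear_combination hx2 - (p - q) * hx
  have h4 : q * (1 + 2 * e) = e - e ^ 2 := by
    subst hp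
    linear_combination -h3 + (1 - 3 * q) * hq2 - q * he
  have h5 : q ^ 2 * (1 + 2 * e) ^ 2 = (e - e ^ 2) ^ 2 := by rw [← h4]; ring
  have h6 : e * (e ^ 3 + 5 * e ^ 2 + 2 * e + 1) = 0 := by
    linear_combination h5 - (1 + 2 * e) ^ 2 * hq2 + e * (1 + 2 * e) * h4
  have h7 : 0 < e * (e ^ 3 + 5 * e ^ 2 + 2 * e + 1) := by positivity
  exact h7.ne' h6

/-- The `m`'s are entries of `F_{αρ}^{ρρρ}` in the row (`mr`) and column (`mc`) of `ρ` and the row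
of `_αρ` (`mx`); the `n`'s form the column `_αρ` of `F_ρ^{αρ,ρ,ρ}`. For `a = 0` each exchange
relation loses its term at `ρ`, so together with normalization it is a linear system in two squared
moduli. -/
theorem normSq_relations {b m0 mr1 mr2 mc1 mc2 mxx mxy n0 nxx nyx : ℂ} {p q : ℝ} (hb : b ≠ 0)
    (hpq : p - q ≠ 0) (hm : m0 = p)
    (Mc : b * p * Complex.normSq mc1 + b * q * Complex.normSq mc2 = 0)
    (Nc : b * p * Complex.normSq nxx + b * q * Complex.normSq nyx = 0)
    (Mr : mr1 * (b * p) * star mr1 + mr2 * (b * q) * star mr2 = 0)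
    (Mx : mxx * (b * p) * star mr1 + mxy * (b * q) * star mr2 = b * p * mc1)
    (uMc : star m0 * m0 + star mc1 * mc1 + star mc2 * mc2 = 1)
    (uNc : star n0 * n0 + star nxx * nxx + star nyx * nyx = 1)
    (uMr : m0 * star m0 + mr1 * star mr1 + mr2 * star mr2 = 1)
    (uMx : mc1 * star m0 + mxx * star mr1 + mxy * star mr2 = 0) :
    Complex.normSq mc1 * (p - q) = -q * (1 - p ^ 2) ∧
      Complex.normSq nxx * (p - q) = -q * (1 - Complex.normSq n0) ∧
      Complex.normSq mxx * Complex.normSq mc1 * (p - q) ^ 2 =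
        p ^ 2 * (1 + q) ^ 2 * Complex.normSq mc1 := by
  subst hm
  simp only [Complex.star_def, Complex.conj_ofReal] at *
  have a1 : (p : ℂ) * Complex.normSq mc1 + q * Complex.normSq mc2 = 0 := by
    apply mul_left_cancel₀ hb; linear_combination Mc
  have a2 : (p : ℂ) * Complex.normSq nxx + q * Complex.normSq nyx = 0 := by
    apply mul_left_cancel₀ hb; linear_combination Nc
  have a3 : (p : ℂ) * Complex.normSq mr1 + q * Complex.normSq mr2 = 0 := by
    apply mul_left_cancel₀ hb
    rw [← Complex.mul_conj, ← Complex.mul_conj]; linear_combination Mr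
  have a4 : (p : ℂ) * (mxx * star mr1) + q * (mxy * star mr2) = p * mc1 := by
    apply mul_left_cancel₀ hb
    rw [Complex.star_def]
    linear_combination Mx
  have a5 : mxx * star mr1 * (p - q) = p * (1 + q) * mc1 := by
    rw [Complex.star_def] at a4 ⊢
    linear_combination a4 - q * uMx
  have b1 : (p : ℂ) ^ 2 + Complex.normSq mc1 + Complex.normSq mc2 = 1 := by
    rw [← Complex.mul_conj, ← Complex.mul_conj]; linear_combination uMc
  have b2 : (Complex.normSq n0 : ℂ) + Complex.normSq nxx + Complex.normSq nyx = 1 := by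
    rw [← Complex.mul_conj, ← Complex.mul_conj, ← Complex.mul_conj]; linear_combination uNc
  have b3 : (p : ℂ) ^ 2 + Complex.normSq mr1 + Complex.normSq mr2 = 1 := by
    rw [← Complex.mul_conj, ← Complex.mul_conj]; linear_combination uMr
  norm_cast at a1 a2 a3 b1 b2 b3
  have a6 := congrArg Complex.normSq a5
  have c1 : Complex.normSq mc1 * (p - q) = -q * (1 - p ^ 2) := by
    linear_combination a1 - q * b1
  have c2 : Complex.normSq mr1 * (p - q) = -q * (1 - p ^ 2) := by
    linear_combination a3 - q * b3
  have c3 : Complex.normSq mr1 = Complex.normSq mc1 :=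
    mul_right_cancel₀ hpq (c2.trans c1.symm)
  refine ⟨c1, by linear_combination a2 - q * b2, ?_⟩
  have e1 : ((p : ℂ) - q) = ((p - q : ℝ) : ℂ) := by push_cast; ring
  have e2 : (1 + (q : ℂ)) = ((1 + q : ℝ) : ℂ) := by push_cast; ring
  rw [e1, e2] at a6
  simp only [map_mul, Complex.star_def, Complex.normSq_conj, Complex.normSq_ofReal] at a6
  rw [c3] at a6
  linear_combination a6

theorem IsUnitary.rungEigenvalue_ne_zero (hV : V.IsUnitary) {a p q : ℝ}
    (h : RungEigenvalues V a p q) : a ≠ 0 := by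
  rintro rfl
  set e := dRho⁻¹ with he
  have hbC := sqrt_dRho_ne_zero
  obtain ⟨η, hη⟩ : ∃ η : H3Label → ℂ, (∀ j ∈ H3Label.fusion .rho .rho,
      V.vert .rho .rho j ≫ H.tri.rung = η j • V.vert .rho .rho j) ∧ η .rho = 0 ∧
      η .alRho = (Real.sqrt dRho : ℂ) * p ∧ η .alSRho = (Real.sqrt dRho : ℂ) * q := by
    refine ⟨fun j => match j with
      | .one => (Real.sqrt dRho : ℂ)
      | .rho => 0
      | .alRho => (Real.sqrt dRho : ℂ) * p
      | .alSRho => (Real.sqrt dRho : ℂ) * q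
      | _ => 0, ?_, rfl, rfl, rfl⟩
    intro j hj
    cases j
    · exact h.one
    · exact absurd hj (by decide)
    · exact absurd hj (by decide)
    · have := h.rho
      simp only [Complex.ofReal_zero, mul_zero] at this
      exact this
    · exact h.alRho
    · exact h.alSRho
  obtain ⟨hη, η0, ηp, ηq⟩ := hη
  obtain ⟨κ, hκ⟩ := V.exists_eigenvalue (H.tri.rungAt (V.vert .alRho .rho .alRho))
  obtain ⟨θ, hθ, hα⟩ := hV.exists_alpha_rung
  -- Tensoring with `α` takes `ρ` to `_αρ` and `_{α*}ρ` to `ρ`, so on the strand `_αρ` these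
  -- channels carry `θ h_ρ` and `θ h_{α*ρ}`.
  have κ1 : κ .alRho = 0 := by
    rw [hα .alRho .rho 0 (κ .alRho) (by decide) (by decide) (by decide)
      (by rw [← η0]; exact hη _ (by decide)) (hκ _ (by decide)), mul_zero]
  have κ2 : κ .rho = θ * ((Real.sqrt dRho : ℂ) * q) :=
    hα .rho .alSRho _ (κ .rho) (by decide) (by decide) (by decide) h.alSRho (hκ _ (by decide))
  have hη' : ∀ k ∈ H3Label.fusion .rho .rho,
      V.vert .rho .rho k ≫ H.tri.rungAt (V.vert .rho .rho .rho) = η k • V.vert .rho .rho k := by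
    intro k hk
    rw [V.vert_vertex]
    exact hη k hk
  have hrot := hV.normSq_rotation
  have M0 := hV.F_rho_self (Y := .rho) (u := .alRho) (by decide) (by decide)
    (hη' .alRho (by decide))
  have N0 := hV.F_rho_self (Y := .alRho) (u := .rho) (by decide) (by decide)
    (hκ .rho (by decide))
  have Mc := hV.rung_exchange_col (Y := .rho) (u := .alRho) (by decide) (by decide) hη' hη
  have Nc := hV.rung_exchange_col (Y := .alRho) (u := .rho) (by decide) (by decide) hκ hη
  have Mr := hV.rung_exchange (Y := .rho) (u := .alRho) (by decide) (by decide) hη' hη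
    (j := .rho) (by decide)
  have Mx := hV.rung_exchange (Y := .rho) (u := .alRho) (by decide) (by decide) hη' hη
    (j := .alRho) (by decide)
  have uMc := hV.col (x := .rho) (y := .rho) (z := .rho) (u := .alRho) (k := .rho) (l := .rho)
    (by decide)
  have uNc := hV.col (x := .alRho) (y := .rho) (z := .rho) (u := .rho) (k := .alRho)
    (l := .alRho) (by decide)
  have uMr := hV.row (x := .rho) (y := .rho) (z := .rho) (u := .alRho) (i := .rho) (j := .rho)
    (by decide)
  have uMx := hV.row (x := .rho) (y := .rho) (z := .rho) (u := .alRho) (i := .alRho) (j := .rho)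
    (by decide)
  rw [H3Label.sum_eq] at Mc Nc Mr Mx uMc uNc uMr uMx
  have zM1 : ∀ j, V.F .rho .rho .rho .alRho j .al = 0 := fun j => F_eq_zero fun h' =>
    absurd h'.2 (by decide)
  have zM2 : ∀ j, V.F .rho .rho .rho .alRho j .alS = 0 := fun j => F_eq_zero fun h' =>
    absurd h'.2 (by decide)
  have zM3 : ∀ j, V.F .rho .rho .rho .alRho j .one = 0 := fun j => F_eq_zero fun h' =>
    absurd h'.2 (by decide)
  have zM4 : ∀ j, V.F .rho .rho .rho .alRho .al j = 0 := fun j => F_eq_zero fun h' =>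
    absurd h'.1 (by decide)
  have zM5 : ∀ j, V.F .rho .rho .rho .alRho .alS j = 0 := fun j => F_eq_zero fun h' =>
    absurd h'.1 (by decide)
  have zM6 : ∀ j, V.F .rho .rho .rho .alRho .one j = 0 := fun j => F_eq_zero fun h' =>
    absurd h'.1 (by decide)
  have zN4 : ∀ j, V.F .alRho .rho .rho .rho .al j = 0 := fun j => F_eq_zero fun h' =>
    absurd h'.1 (by decide)
  have zN5 : ∀ j, V.F .alRho .rho .rho .rho .alS j = 0 := fun j => F_eq_zero fun h' =>
    absurd h'.1 (by decide)
  have zN6 : ∀ j, V.F .alRho .rho .rho .rho .one j = 0 := fun j => F_eq_zero fun h' =>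
    absurd h'.1 (by decide)
  simp only [zM1, zM2, zM3, zM4, zM5, zM6, zN4, zN5, zN6, η0, ηp, ηq, κ1, zero_mul, mul_zero,
    zero_add, add_zero, map_zero, star_zero, if_true, reduceCtorEq, if_false] at Mc Nc Mr Mx uMc uNc uMr uMx
  have hM : V.F .rho .rho .rho .alRho .rho .rho = p := by
    apply mul_right_cancel₀ hbC
    rw [M0, ηp, mul_comm]
  have hN : Complex.normSq (V.F .alRho .rho .rho .rho .rho .alRho) = q ^ 2 := by
    have : V.F .alRho .rho .rho .rho .rho .alRho = θ * q := by
      apply mul_right_cancel₀ hbC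
      rw [N0, κ2]; ring
    rw [this, map_mul, hθ, Complex.normSq_ofReal]; ring
  simp only [Complex.ofReal_zero, mul_zero, zero_add] at Mc Nc
  have hpq : p - q ≠ 0 := by
    intro h0
    have h1 := h.moment_one
    have h2 := h.moment_two
    have h3 := inv_dRho_sq
    have h4 := inv_dRho_pos
    obtain rfl : p = q := by linarith
    nlinarith
  obtain ⟨c1, c2, c3⟩ := normSq_relations hbC hpq hM Mc Nc Mr Mx uMc uNc uMr uMx
  -- The rotation replaces `|N_{αρ,αρ}|²` by `|M_{αρ,αρ}|²`, giving the second formula for the same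
  -- modulus.
  rw [hN, hrot] at c2
  exact no_zero_solution inv_dRho_sq inv_dRho_pos (by linarith [h.moment_one])
    (by linarith [h.moment_two]) c1 c2 c3

end Gauge

end H3Category

/-! ### Excluding `a = (2 - e)/3`: normal forms of planar diagrams -/

namespace TrivalentVertex

variable {C : Type u} [Category.{v} C] [MonoidalCategory C] {X : C} (T : TrivalentVertex X)

theorem cupAt_naturality {Y Z : C} (g : Y ⟶ Z) :
    T.cupAt Y ≫ g ▷ X ▷ X = g ≫ T.cupAt Z := by
  calc _ = 𝟙 Y ⊗≫ (Y ◁ T.cup ≫ g ▷ (X ⊗ X)) ⊗≫ 𝟙 ((Z ⊗ X) ⊗ X) := by rw [cupAt]; monoidal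
    _ = _ := by rw [whisker_exchange, cupAt]; monoidal

theorem vertAt_naturality {Y Z : C} (g : Y ⟶ Z) :
    T.vertAt Y ≫ g ▷ X ▷ X = g ▷ X ≫ T.vertAt Z := by
  calc _ = (Y ◁ T.vertex ≫ g ▷ (X ⊗ X)) ⊗≫ 𝟙 ((Z ⊗ X) ⊗ X) := by rw [vertAt]; monoidal
    _ = _ := by rw [whisker_exchange, vertAt]; monoidal

theorem mergeAt_naturality {Y Z : C} (g : Y ⟶ Z) :
    g ▷ X ▷ X ≫ T.mergeAt Z = T.mergeAt Y ≫ g ▷ X := by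
  calc _ = 𝟙 ((Y ⊗ X) ⊗ X) ⊗≫ (g ▷ (X ⊗ X) ≫ Z ◁ T.merge) := by rw [mergeAt]; monoidal
    _ = _ := by rw [← whisker_exchange, mergeAt]; monoidal

end TrivalentVertex

namespace TensorWord

variable {C : Type u} [Category.{v} C] [MonoidalCategory C]

/-- The left-nested tensor powers of an object. -/
abbrev power (X : C) : ℕ → C
  | 0 => 𝟙_ C
  | n + 1 => power X n ⊗ X

/-- The length of a word, added to `n`. -/
abbrev length : TensorWord → ℕ → ℕ
  | .unit, n => n
  | .gen, n => n + 1
  | .tensor w w', n => w'.length (w.length n)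

/-- Removing the brackets of a word that stands to the right of a left-nested tensor power. -/
def append (X : C) : (w : TensorWord) → (n : ℕ) → (power X n ⊗ w.eval X ≅ power X (w.length n))
  | .unit, n => ρ_ (power X n)
  | .gen, n => Iso.refl (power X n ⊗ X)
  | .tensor w w', n => (α_ (power X n) (w.eval X) (w'.eval X)).symm ≪≫
      whiskerRightIso (append X w n) (w'.eval X) ≪≫ append X w' (w.length n)

/-- The word of the left-nested fourth tensor power. -/
def four : TensorWord :=
  .tensor (.tensor (.tensor (.tensor .unit .gen) .gen) .gen) .gen

theorem append_four (X : C) : (append X TensorWord.four 0).hom = (λ_ (power X 4)).hom := by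
  simp [append, TensorWord.four, power, TensorWord.eval, TensorWord.length]
  monoidal

end TensorWord

namespace TrivalentVertex

open TensorWord

variable {C : Type u} [Category.{v} C] [MonoidalCategory C] {X : C} (T : TrivalentVertex X)

/-- A cup or a vertex, between strands. -/
inductive Up : (n m : ℕ) → (power X n ⟶ power X m) → Prop
  | cup (n : ℕ) : Up n (n + 2) (T.cupAt (power X n))
  | vert (n : ℕ) : Up (n + 1) (n + 2) (T.vertAt (power X n))
  | whisker {n m : ℕ} {f : power X n ⟶ power X m} : Up n m f → Up (n + 1) (m + 1) (f ▷ X)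

/-- A cap or an inverted vertex, between strands. -/
inductive Down : (n m : ℕ) → (power X n ⟶ power X m) → Prop
  | cap (n : ℕ) : Down (n + 2) n (T.capAt (power X n))
  | merge (n : ℕ) : Down (n + 2) (n + 1) (T.mergeAt (power X n))
  | whisker {n m : ℕ} {f : power X n ⟶ power X m} : Down n m f → Down (n + 1) (m + 1) (f ▷ X)

/-- The diagrams without inputs that consist of cups and vertices. -/
inductive Built : (n : ℕ) → (power X 0 ⟶ power X n) → Prop
  | id : Built 0 (𝟙 _)
  | step {n m : ℕ} {f : power X 0 ⟶ power X n} {g : power X n ⟶ power X m} :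
      Built n f → T.Up n m g → Built m (f ≫ g)

variable [Preadditive C] [Linear ℂ C]

/-- The linear combinations of diagrams made from cups, caps and vertices. -/
inductive Layered : (n m : ℕ) → (power X n ⟶ power X m) → Prop
  | id (n : ℕ) : Layered n n (𝟙 _)
  | up {n m : ℕ} {f : power X n ⟶ power X m} : T.Up n m f → Layered n m f
  | down {n m : ℕ} {f : power X n ⟶ power X m} : T.Down n m f → Layered n m f
  | comp {n m l : ℕ} {f : power X n ⟶ power X m} {g : power X m ⟶ power X l} :
      Layered n m f → Layered m l g → Layered n l (f ≫ g)
  | zero (n m : ℕ) : Layered n m 0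
  | add {n m : ℕ} {f g : power X n ⟶ power X m} :
      Layered n m f → Layered n m g → Layered n m (f + g)
  | smul {n m : ℕ} (r : ℂ) {f : power X n ⟶ power X m} : Layered n m f → Layered n m (r • f)

/-- The linear combinations of diagrams in which no `Up` is followed by a `Down`, with at most one
of each. -/
inductive Sorted : (n m : ℕ) → (power X n ⟶ power X m) → Prop
  | id (n : ℕ) : Sorted n n (𝟙 _)
  | up {n m : ℕ} {f : power X n ⟶ power X m} : T.Up n m f → Sorted n m f
  | down {n m : ℕ} {f : power X n ⟶ power X m} : T.Down n m f → Sorted n m f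
  | down_up {n m l : ℕ} {f : power X n ⟶ power X m} {g : power X m ⟶ power X l} :
      T.Down n m f → T.Up m l g → Sorted n l (f ≫ g)
  | zero (n m : ℕ) : Sorted n m 0
  | add {n m : ℕ} {f g : power X n ⟶ power X m} :
      Sorted n m f → Sorted n m g → Sorted n m (f + g)
  | smul {n m : ℕ} (r : ℂ) {f : power X n ⟶ power X m} : Sorted n m f → Sorted n m (r • f)

/-- The relations of a trivalent vertex that is the multiplication of a Frobenius algebra without
its unit. -/
structure IHRelation (d b c : ℂ) : Prop where
  loop : T.cup ≫ T.cap = d • 𝟙 (𝟙_ C)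
  cup_merge : T.cup ≫ T.merge = 0
  vertex_cap : T.vertex ≫ T.cap = 0
  bigon : T.vertex ≫ T.merge = b • 𝟙 X
  rung : T.rung = T.merge ≫ T.vertex + c • (𝟙 (X ⊗ X) + (-1 : ℂ) • (T.cap ≫ T.cup))

variable {d b c : ℂ} {T}

variable (T) in
/-- The span of the diagrams without inputs that consist of cups and vertices. -/
def builtSpan (n : ℕ) : Submodule ℂ (power X 0 ⟶ power X n) :=
  Submodule.span ℂ {f | T.Built n f}

theorem builtSpan_up {n m : ℕ} {f : power X 0 ⟶ power X n} {g : power X n ⟶ power X m}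
    (hf : f ∈ T.builtSpan n) (hg : T.Up n m g) : f ≫ g ∈ T.builtSpan m := by
  induction hf using Submodule.span_induction with
  | mem f hf => exact Submodule.subset_span (Built.step hf hg)
  | zero => rw [zero_comp]; exact zero_mem _
  | add f f' _ _ h h' => rw [Preadditive.add_comp]; exact add_mem h h'
  | smul r f _ h => rw [Linear.smul_comp]; exact Submodule.smul_mem _ r h

variable [MonoidalPreadditive C]

theorem IHRelation.cupAt_mergeAt (h : T.IHRelation d b c) (Y : C) :
    T.cupAt Y ≫ T.mergeAt Y = 0 := by
  rw [cupAt, mergeAt]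
  simp only [Category.assoc, Iso.inv_hom_id_assoc]
  rw [← MonoidalCategory.whiskerLeft_comp, h.cup_merge]
  simp

theorem IHRelation.vertAt_capAt (h : T.IHRelation d b c) (Y : C) :
    T.vertAt Y ≫ T.capAt Y = 0 := by
  rw [vertAt, capAt]
  simp only [Category.assoc, Iso.inv_hom_id_assoc]
  rw [← MonoidalCategory.whiskerLeft_comp_assoc, h.vertex_cap]
  simp

variable [MonoidalLinear ℂ C]

theorem Layered.whisker {n m : ℕ} {f : power X n ⟶ power X m} (h : T.Layered n m f) :
    T.Layered (n + 1) (m + 1) (f ▷ X) := by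
  induction h with
  | id n => rw [id_whiskerRight]; exact Layered.id (n + 1)
  | up h => exact .up h.whisker
  | down h => exact .down h.whisker
  | comp _ _ ih ih' => rw [comp_whiskerRight]; exact .comp ih ih'
  | zero n m => rw [MonoidalPreadditive.zero_whiskerRight]; exact .zero (n + 1) (m + 1)
  | add _ _ ih ih' => rw [MonoidalPreadditive.add_whiskerRight]; exact .add ih ih'
  | smul r _ ih => rw [MonoidalLinear.smul_whiskerRight]; exact .smul r ih

theorem Sorted.whisker {n m : ℕ} {f : power X n ⟶ power X m} (h : T.Sorted n m f) :
    T.Sorted (n + 1) (m + 1) (f ▷ X) := by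
  induction h with
  | id => rw [id_whiskerRight]; exact Sorted.id (_ + 1)
  | up h => exact .up h.whisker
  | down h => exact .down h.whisker
  | down_up h h' => rw [comp_whiskerRight]; exact .down_up h.whisker h'.whisker
  | zero => rw [MonoidalPreadditive.zero_whiskerRight]; exact .zero (_ + 1) (_ + 1)
  | add _ _ ih ih' => rw [MonoidalPreadditive.add_whiskerRight]; exact .add ih ih'
  | smul r _ ih => rw [MonoidalLinear.smul_whiskerRight]; exact .smul r ih

theorem Layered.whiskerRight_word (w : TensorWord) {n m : ℕ} {f : power X n ⟶ power X m}
    (h : T.Layered n m f) : ∃ g, T.Layered (w.length n) (w.length m) g ∧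
      f ▷ w.eval X ≫ (append X w m).hom = (append X w n).hom ≫ g := by
  induction w generalizing n m f with
  | unit => exact ⟨f, h, by simp [append, TensorWord.eval]⟩
  | gen =>
    refine ⟨f ▷ X, h.whisker, ?_⟩
    simp [append, TensorWord.eval]
  | tensor w w' ih ih' =>
    obtain ⟨g, hg, e⟩ := ih h
    obtain ⟨g', hg', e'⟩ := ih' hg
    refine ⟨g', hg', ?_⟩
    simp only [append, TensorWord.eval, Iso.trans_hom, Iso.symm_hom, whiskerRightIso_hom,
      Category.assoc]
    rw [← e', ← comp_whiskerRight_assoc, ← e]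
    simp

/-- The `n` strands on the left make the induction work: in `f ⊗ g` the morphism `g` stands to the
right of the strands of `f`. Structural isomorphisms become identities once brackets are removed. -/
theorem Generated.layered {w w' : TensorWord} {f : w.eval X ⟶ w'.eval X}
    (h : T.Generated w w' f) (n : ℕ) : ∃ g, T.Layered (w.length n) (w'.length n) g ∧
      power X n ◁ f ≫ (append X w' n).hom = (append X w n).hom ≫ g := by
  induction h generalizing n with
  | id w => exact ⟨𝟙 _, .id _, by simp⟩
  | assoc_hom w₁ w₂ w₃ =>
    refine ⟨𝟙 _, Layered.id _, ?_⟩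
    simp [append, TensorWord.eval, TensorWord.length]
  | assoc_inv w₁ w₂ w₃ =>
    refine ⟨𝟙 _, Layered.id _, ?_⟩
    simp [append, TensorWord.eval, TensorWord.length]
  | left_unitor_hom w =>
    refine ⟨𝟙 _, Layered.id _, ?_⟩
    simp [append, TensorWord.eval, TensorWord.length]
  | left_unitor_inv w =>
    refine ⟨𝟙 _, Layered.id _, ?_⟩
    simp [append, TensorWord.eval, TensorWord.length]
  | right_unitor_hom w =>
    refine ⟨𝟙 _, Layered.id _, ?_⟩
    simp [append, TensorWord.eval, TensorWord.length]
  | right_unitor_inv w =>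
    refine ⟨𝟙 _, Layered.id _, ?_⟩
    simp [append, TensorWord.eval, TensorWord.length]
  | cup =>
    refine ⟨T.cupAt (power X n), .up (.cup n), ?_⟩
    simp [append, TensorWord.eval, TensorWord.length, cupAt, power]
  | cap =>
    refine ⟨T.capAt (power X n), .down (.cap n), ?_⟩
    simp [append, TensorWord.eval, TensorWord.length, capAt, power]
  | vertex =>
    refine ⟨T.vertAt (power X n), .up (.vert n), ?_⟩
    simp [append, TensorWord.eval, TensorWord.length, vertAt, power]
  | comp _ _ ih ih' =>
    obtain ⟨g, hg, e⟩ := ih n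
    obtain ⟨g', hg', e'⟩ := ih' n
    refine ⟨g ≫ g', hg.comp hg', ?_⟩
    rw [MonoidalCategory.whiskerLeft_comp, Category.assoc, e', reassoc_of% e]
  | @tensor w₁ w₂ w₃ w₄ f g _ _ ih ih' =>
    obtain ⟨φ, hφ, e⟩ := ih n
    obtain ⟨ψ, hψ, e'⟩ := ih' (w₂.length n)
    obtain ⟨φ', hφ', e''⟩ := hφ.whiskerRight_word w₃
    refine ⟨φ' ≫ ψ, hφ'.comp hψ, ?_⟩
    simp only [append, TensorWord.eval, Iso.trans_hom, Iso.symm_hom, whiskerRightIso_hom,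
      Category.assoc]
    rw [← reassoc_of% e'', ← e', ← comp_whiskerRight_assoc, ← e, MonoidalCategory.tensorHom_def]
    simp [← whisker_exchange_assoc]
  | zero w w' => exact ⟨0, .zero _ _, by simp⟩
  | add _ _ ih ih' =>
    obtain ⟨g, hg, e⟩ := ih n
    obtain ⟨g', hg', e'⟩ := ih' n
    refine ⟨g + g', hg.add hg', ?_⟩
    rw [MonoidalPreadditive.whiskerLeft_add, Preadditive.add_comp, e, e', Preadditive.comp_add]
  | smul r _ ih =>
    obtain ⟨g, hg, e⟩ := ih n
    refine ⟨r • g, hg.smul r, ?_⟩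
    rw [MonoidalLinear.whiskerLeft_smul, Linear.smul_comp, e, Linear.comp_smul]

theorem IHRelation.cupAt_capAt (h : T.IHRelation d b c) (Y : C) :
    T.cupAt Y ≫ T.capAt Y = d • 𝟙 Y := by
  rw [cupAt, capAt]
  simp only [Category.assoc, Iso.inv_hom_id_assoc]
  rw [← MonoidalCategory.whiskerLeft_comp_assoc, h.loop]
  simp [MonoidalLinear.whiskerLeft_smul, -Complex.coe_smul]

theorem IHRelation.vertAt_mergeAt (h : T.IHRelation d b c) (Y : C) :
    T.vertAt Y ≫ T.mergeAt Y = b • 𝟙 (Y ⊗ X) := by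
  rw [vertAt, mergeAt]
  simp only [Category.assoc, Iso.inv_hom_id_assoc]
  rw [← MonoidalCategory.whiskerLeft_comp, h.bigon]
  simp [MonoidalLinear.whiskerLeft_smul]

theorem IHRelation.sorted_rung (h : T.IHRelation d b c) (n : ℕ) :
    T.Sorted (n + 2) (n + 2) ((α_ (power X n) X X).hom ≫ power X n ◁ T.rung ≫
      (α_ (power X n) X X).inv) := by
  have : (α_ (power X n) X X).hom ≫ power X n ◁ T.rung ≫ (α_ (power X n) X X).inv =
      T.mergeAt (power X n) ≫ T.vertAt (power X n) +
        c • (𝟙 ((power X n ⊗ X) ⊗ X) + (-1 : ℂ) • (T.capAt (power X n) ≫ T.cupAt (power X n))) := by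
    rw [h.rung, mergeAt, vertAt, capAt, cupAt]
    simp [MonoidalLinear.whiskerLeft_smul, MonoidalPreadditive.whiskerLeft_add, -neg_smul, -Complex.coe_smul]
  rw [this]
  exact .add (.down_up (.merge n) (.vert n)) (.smul c (.add (.id (n + 2))
    (.smul _ (.down_up (.cap n) (.cup n)))))

/-- Distant layers commute. Layers on the same strands give a loop, a bigon or zero; layers shifted
by one strand give a zigzag, a rotated vertex or a rung. Only the rung needs the relation that
expresses it by sorted diagrams. -/
theorem IHRelation.sorted (h : T.IHRelation d b c) {n m l : ℕ} {f : power X n ⟶ power X m}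
    {g : power X m ⟶ power X l} (hf : T.Up n m f) (hg : T.Down m l g) :
    T.Sorted n l (f ≫ g) := by
  induction hf generalizing l with
  | cup n =>
    cases hg with
    | cap => rw [h.cupAt_capAt]; exact .smul d (.id n)
    | merge => rw [h.cupAt_mergeAt]; exact .zero n (n + 1)
    | whisker hg =>
      cases hg with
      | cap =>
        rename_i k
        have := T.cupAt_comp_capAt_whiskerRight (power X k)
        rw [show T.cupAt (power X (k + 1)) ≫ T.capAt (power X k) ▷ X = _ from this]
        exact .id (k + 1)
      | merge =>
        rename_i k
        have := T.cupAt_comp_mergeAt_whiskerRight (power X k)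
        rw [show T.cupAt (power X (k + 1)) ≫ T.mergeAt (power X k) ▷ X = _ from this]
        exact .up (.vert k)
      | whisker hg =>
        rw [T.cupAt_naturality]
        exact .down_up hg (.cup _)
  | vert n =>
    cases hg with
    | cap => rw [h.vertAt_capAt]; exact .zero (n + 1) n
    | merge => rw [h.vertAt_mergeAt]; exact .smul b (.id (n + 1))
    | whisker hg =>
      cases hg with
      | cap =>
        rename_i k
        have := T.vertAt_comp_capAt_whiskerRight (power X k)
        rw [show T.vertAt (power X (k + 1)) ≫ T.capAt (power X k) ▷ X = _ from this]
        exact .down (.merge k)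
      | merge =>
        rename_i k
        have := T.vertAt_comp_mergeAt_whiskerRight (power X k)
        rw [show T.vertAt (power X (k + 1)) ≫ T.mergeAt (power X k) ▷ X = _ from this]
        exact h.sorted_rung k
      | whisker hg =>
        rw [T.vertAt_naturality]
        exact .down_up hg.whisker (.vert _)
  | whisker hf ih =>
    cases hg with
    | cap k =>
      cases hf with
      | cup =>
        rename_i n
        have := T.cupAt_whiskerRight_comp_capAt (power X n)
        rw [show T.cupAt (power X n) ▷ X ≫ T.capAt (power X (n + 1)) = _ from this]
        exact .id (n + 1)
      | vert n =>
        have := T.vertAt_whiskerRight_comp_capAt (power X n)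
        rw [show T.vertAt (power X n) ▷ X ≫ T.capAt (power X (n + 1)) = _ from this]
        exact .down (.merge n)
      | whisker hf =>
        rw [T.capAt_naturality]
        exact .down_up (.cap _) hf
    | merge k =>
      cases hf with
      | cup =>
        rename_i n
        have := T.cupAt_whiskerRight_comp_mergeAt (power X n)
        rw [show T.cupAt (power X n) ▷ X ≫ T.mergeAt (power X (n + 1)) = _ from this]
        exact .up (.vert n)
      | vert n =>
        have := T.vertAt_whiskerRight_comp_mergeAt (power X n)
        rw [show T.vertAt (power X n) ▷ X ≫ T.mergeAt (power X (n + 1)) = _ from this]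
        exact h.sorted_rung n
      | whisker hf =>
        rw [T.mergeAt_naturality]
        exact .down_up (.merge _) hf.whisker
    | whisker hg =>
      rw [← comp_whiskerRight]
      exact (ih hg).whisker

/-- The `Down` is moved past the last `Up` by `sorted`, then handled by induction. It must
disappear, since no `Down` starts from zero strands. -/
theorem IHRelation.built_down (h : T.IHRelation d b c) {n : ℕ} {f : power X 0 ⟶ power X n}
    (hf : T.Built n f) : ∀ {m : ℕ} {g : power X n ⟶ power X m}, T.Down n m g →
      f ≫ g ∈ T.builtSpan m := by
  induction hf with
  | id => intro m g hg; cases hg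
  | @step n m f u hf hu ih =>
    intro l g hg
    rw [Category.assoc]
    have := h.sorted hu hg
    generalize u ≫ g = x at this
    clear hu hg g u
    induction this with
    | id => rw [Category.comp_id]; exact Submodule.subset_span hf
    | up hu => exact Submodule.subset_span (hf.step hu)
    | down hg => exact ih hg
    | down_up hg hu => rw [← Category.assoc]; exact builtSpan_up (ih hg) hu
    | zero => rw [comp_zero]; exact zero_mem _
    | add _ _ h h' => rw [Preadditive.comp_add]; exact add_mem h h'
    | smul r _ h => rw [Linear.comp_smul]; exact Submodule.smul_mem _ r h

theorem IHRelation.builtSpan_layered (h : T.IHRelation d b c) {n m : ℕ}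
    {g : power X n ⟶ power X m} (hg : T.Layered n m g) {f : power X 0 ⟶ power X n}
    (hf : f ∈ T.builtSpan n) : f ≫ g ∈ T.builtSpan m := by
  induction hg with
  | id => rwa [Category.comp_id]
  | up hu => exact builtSpan_up hf hu
  | down hd =>
    induction hf using Submodule.span_induction with
    | mem f hf => exact h.built_down hf hd
    | zero => rw [zero_comp]; exact zero_mem _
    | add f f' _ _ h h' => rw [Preadditive.add_comp]; exact add_mem h h'
    | smul r f _ h => rw [Linear.smul_comp]; exact Submodule.smul_mem _ r h
  | comp _ _ ih ih' => rw [← Category.assoc]; exact ih' (ih hf)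
  | zero => rw [comp_zero]; exact zero_mem _
  | add _ _ ih ih' => rw [Preadditive.comp_add]; exact add_mem (ih hf) (ih' hf)
  | smul r _ ih => rw [Linear.comp_smul]; exact Submodule.smul_mem _ r (ih hf)

theorem IHRelation.mem_builtSpan (h : T.IHRelation d b c)
    (hT : ∀ (w w' : TensorWord) (f : w.eval X ⟶ w'.eval X), T.Generated w w' f)
    (f : power X 0 ⟶ power X 4) : f ∈ T.builtSpan 4 := by
  obtain ⟨g, hg, e⟩ := (hT .unit .four f).layered 0
  have h1 : (𝟙 (power X 0)) ∈ T.builtSpan 0 := Submodule.subset_span .id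
  have h2 := h.builtSpan_layered hg h1
  rw [append_four] at e
  have h3 : f = g := by
    have h4 : (λ_ (𝟙_ C)).hom ≫ f = (λ_ (𝟙_ C)).hom ≫ g := by
      rw [← leftUnitor_naturality]
      refine e.trans ?_
      rw [unitors_equal]
      rfl
    exact (cancel_epi _).1 h4
  rw [h3]
  exact (Category.id_comp g) ▸ h2

/-- A built diagram with four outputs is not the empty one, so it ends with an `Up`, which `φ`
kills. -/
theorem IHRelation.comp_eq_zero (h : T.IHRelation d b c)
    (hT : ∀ (w w' : TensorWord) (f : w.eval X ⟶ w'.eval X), T.Generated w w' f)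
    {Z : C} (φ : power X 4 ⟶ Z)
    (hφ : ∀ (n : ℕ) (g : power X n ⟶ power X 4), T.Up n 4 g → g ≫ φ = 0)
    (f : power X 0 ⟶ power X 4) : f ≫ φ = 0 := by
  have hf := h.mem_builtSpan hT f
  induction hf using Submodule.span_induction with
  | mem f hf =>
    cases hf with
    | step hf hg => rw [Category.assoc, hφ _ _ hg, comp_zero]
  | zero => rw [zero_comp]
  | add f f' _ _ h h' => rw [Preadditive.add_comp, h, h', add_zero]
  | smul r f _ h => rw [Linear.smul_comp, h, smul_zero]

end TrivalentVertex

/-! ### A functional that kills every diagram built from cups and vertices -/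

namespace TrivalentVertex

open TensorWord

variable {C : Type u} [Category.{v} C] [MonoidalCategory C] {X : C} (T : TrivalentVertex X)

theorem cupAt_unit : T.cupAt (𝟙_ C) ≫ (λ_ X).hom ▷ X = T.cup := by
  rw [cupAt]; monoidal

theorem vertAt_unit : T.vertAt (𝟙_ C) ≫ (λ_ X).hom ▷ X = (λ_ X).hom ≫ T.vertex := by
  rw [vertAt]; monoidal

/-- Closing a functional on the third tensor power with a cap. -/
def close (N : (X ⊗ X) ⊗ X ⟶ X) : power X 4 ⟶ 𝟙_ C :=
  (λ_ X).hom ▷ X ▷ X ▷ X ≫ N ▷ X ≫ T.cap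

theorem whiskerRight_comp_close {Z : C} (f : Z ⟶ (X ⊗ X) ⊗ X) (N : (X ⊗ X) ⊗ X ⟶ X) :
    (f ▷ X ≫ (λ_ X).inv ▷ X ▷ X ▷ X) ≫ T.close N = (f ≫ N) ▷ X ≫ T.cap := by
  rw [close, Category.assoc, ← comp_whiskerRight_assoc ((λ_ X).inv ▷ X ▷ X), ← comp_whiskerRight,
    ← comp_whiskerRight, Iso.inv_hom_id, id_whiskerRight, id_whiskerRight, id_whiskerRight, Category.id_comp,
    ← comp_whiskerRight_assoc]

variable {T} [Preadditive C] [MonoidalPreadditive C]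

/-- The six hypotheses cover a cup or a vertex on the strands one and two, two and three, or three
and four. -/
theorem Up.comp_close {N : (X ⊗ X) ⊗ X ⟶ X} (h₁ : T.cup ▷ X ≫ N = 0) (h₂ : T.vertex ▷ X ≫ N = 0)
    (h₃ : T.cupAt X ≫ N = 0) (h₄ : T.vertAt X ≫ N = 0)
    (h₅ : T.cupAt (X ⊗ X) ≫ N ▷ X ≫ T.cap = 0) (h₆ : T.vertAt (X ⊗ X) ≫ N ▷ X ≫ T.cap = 0)
    {n : ℕ} {g : power X n ⟶ power X 4} (hg : T.Up n 4 g) : g ≫ T.close N = 0 := by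
  rw [close]
  cases hg with
  | cup =>
    have := T.cupAt_naturality ((λ_ X).hom ▷ X)
    rw [reassoc_of% this, h₅, comp_zero]
  | vert =>
    have := T.vertAt_naturality ((λ_ X).hom ▷ X)
    rw [reassoc_of% this, h₆, comp_zero]
  | whisker hg =>
    cases hg with
    | cup =>
      have := T.cupAt_naturality (λ_ X).hom
      rw [← comp_whiskerRight_assoc, this, ← comp_whiskerRight_assoc, Category.assoc, h₃]
      simp
    | vert =>
      have := T.vertAt_naturality (λ_ X).hom
      rw [← comp_whiskerRight_assoc, this, ← comp_whiskerRight_assoc, Category.assoc, h₄]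
      simp
    | whisker hg =>
      cases hg with
      | cup =>
        rw [← comp_whiskerRight_assoc, ← comp_whiskerRight, T.cupAt_unit,
          ← comp_whiskerRight_assoc, h₁]
        simp
      | vert =>
        rw [← comp_whiskerRight_assoc, ← comp_whiskerRight, T.vertAt_unit,
          comp_whiskerRight, comp_whiskerRight, Category.assoc,
          ← comp_whiskerRight_assoc (T.vertex ▷ X), h₂]
        simp
      | whisker hg =>
        cases hg with
        | whisker hg => cases hg

end TrivalentVertex

namespace H3Category

variable {C : Type u} [Category.{v} C] [MonoidalCategory C] [Abelian C] [Linear ℂ C]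
  [MonoidalPreadditive C] [MonoidalLinear ℂ C] {H : H3Category C}

namespace Gauge

variable {V : H.Gauge}

theorem vert_leftDual {x y z u c k : H3Label} (h : c ≠ k) :
    V.vert x y c ▷ H.obj z ≫ V.leftDual x y z u k = 0 := by
  rw [leftDual, ← comp_whiskerRight_assoc, V.vert_dual_ne h]
  simp

theorem IsUnitary.rightTree_inv_leftDual (hV : V.IsUnitary) {x y z u j k : H3Label}
    (hj : RightAdm x y z u j) (hk : LeftAdm x y z u k) :
    V.rightTree x y z u j ≫ (α_ _ _ _).inv ≫ V.leftDual x y z u k =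
      star (V.F x y z u j k) • 𝟙 _ := by
  rw [← Category.assoc, hV.expand_inv hj, V.sum_leftTree_leftDual hk]

theorem vert_rho_one : V.vert .rho .one .rho = H.unitInv .rho := V.unit_right

theorem rightTree_one_inv :
    V.rightTree .rho .rho .rho .rho .one ≫ (α_ _ _ _).inv = H.tri.cupAt (H.obj .rho) := by
  rw [rightTree, Category.assoc, V.vert_cup, vert_rho_one]
  rfl

theorem rightTree_rho_inv :
    V.rightTree .rho .rho .rho .rho .rho ≫ (α_ _ _ _).inv =
      V.vert .rho .rho .rho ≫ H.tri.vertAt (H.obj .rho) := by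
  rw [rightTree, Category.assoc, TrivalentVertex.vertAt, V.vert_vertex]

theorem hom_ext_left {x y z : H3Label} {W : C} {f g : (H.obj x ⊗ H.obj y) ⊗ H.obj z ⟶ W}
    (h : ∀ c ∈ H3Label.fusion x y, V.vert x y c ▷ H.obj z ≫ f = V.vert x y c ▷ H.obj z ≫ g) :
    f = g := by
  rw [← Category.id_comp f, ← Category.id_comp g, ← id_whiskerRight, ← V.sum_dual_vert,
    sum_whiskerRight, Preadditive.sum_comp, Preadditive.sum_comp]
  refine Finset.sum_congr rfl fun c hc => ?_
  rw [comp_whiskerRight, Category.assoc, Category.assoc, h c hc]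

/-- The functional that vanishes on all compositions of smaller diagrams if the rung has the same
eigenvalue on the two invertible translates of the vertex. -/
noncomputable def difference (V : H.Gauge) :
    (H.obj .rho ⊗ H.obj .rho) ⊗ H.obj .rho ⟶ H.obj .rho :=
  star (V.F .rho .rho .rho .rho .one .alSRho) • V.leftDual .rho .rho .rho .rho .alRho -
    star (V.F .rho .rho .rho .rho .one .alRho) • V.leftDual .rho .rho .rho .rho .alSRho

theorem vert_difference {c : H3Label} (h : c ≠ .alRho) (h' : c ≠ .alSRho) :
    V.vert .rho .rho c ▷ H.obj .rho ≫ V.difference = 0 := by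
  rw [difference, Preadditive.comp_sub, Linear.comp_smul, Linear.comp_smul, vert_leftDual h,
    vert_leftDual h', smul_zero, smul_zero, sub_zero]

theorem IsUnitary.cupAt_difference (hV : V.IsUnitary) :
    H.tri.cupAt (H.obj .rho) ≫ V.difference = 0 := by
  rw [← rightTree_one_inv (V := V), difference, Preadditive.comp_sub, Linear.comp_smul,
    Linear.comp_smul, Category.assoc, Category.assoc,
    hV.rightTree_inv_leftDual (by decide) (by decide),
    hV.rightTree_inv_leftDual (by decide) (by decide), smul_smul, smul_smul, mul_comm, sub_self]

/-- On `_αρ` and `_{α*}ρ` the adjoint entries for `ρ` are those for `1` times the rung eigenvalue.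
As these eigenvalues agree, the combination that cancels for the cup also cancels here. -/
theorem IsUnitary.vertAt_difference (hV : V.IsUnitary) {h : H3Label → ℂ}
    (hh : ∀ j ∈ H3Label.fusion .rho .rho,
      V.vert .rho .rho j ≫ H.tri.rung = h j • V.vert .rho .rho j) (hxy : h .alRho = h .alSRho) :
    H.tri.vertAt (H.obj .rho) ≫ V.difference = 0 := by
  apply V.hom_ext
  intro c _
  rw [comp_zero]
  by_cases hc : c = .rho
  · subst hc
    rw [← Category.assoc, ← rightTree_rho_inv (V := V), difference, Preadditive.comp_sub,
      Linear.comp_smul, Linear.comp_smul, Category.assoc, Category.assoc,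
      hV.rightTree_inv_leftDual (by decide) (by decide),
      hV.rightTree_inv_leftDual (by decide) (by decide), smul_smul, smul_smul,
      hV.star_F_rho_eq hh (by decide), hV.star_F_rho_eq hh (by decide), hxy, sub_eq_zero]
    congr 1
    ring
  · exact H.hom_eq_zero hc _

theorem cupAt_difference_cap :
    H.tri.cupAt (H.obj .rho ⊗ H.obj .rho) ≫ V.difference ▷ H.obj .rho ≫ H.capOne = 0 := by
  apply V.hom_ext
  intro c _
  rw [comp_zero]
  by_cases hc : c = .one
  · subst hc
    have := H.tri.cupAt_naturality (V.vert .rho .rho .one)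
    rw [← Category.assoc, ← this, Category.assoc, ← comp_whiskerRight_assoc,
      vert_difference (by decide) (by decide)]
    simp
  · exact H.hom_eq_zero hc _

/-- Only the channel `ρ` of the first two strands can pair with the remaining strand to `1`, and the
functional vanishes on that channel. -/
theorem vertAt_difference_cap :
    H.tri.vertAt (H.obj .rho ⊗ H.obj .rho) ≫ V.difference ▷ H.obj .rho ≫ H.capOne = 0 := by
  apply V.hom_ext_left
  intro c _
  rw [comp_zero]
  by_cases hc : c = .rho
  · subst hc
    have := H.tri.vertAt_naturality (V.vert .rho .rho .rho)
    rw [← Category.assoc, ← this, Category.assoc, ← comp_whiskerRight_assoc,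
      vert_difference (by decide) (by decide)]
    simp
  · apply V.hom_ext
    intro k hk
    rw [comp_zero]
    refine H.hom_eq_zero ?_ _
    rintro rfl
    revert hk hc
    cases c <;> decide

/-- The rung as a combination of the other diagrams, if its eigenvalues on the two invertible
translates of the vertex agree. -/
theorem RungEigenvalues.ihRelation {a p : ℝ} (h : RungEigenvalues V a p p) (h1 : 1 + p = a)
    (h2 : p * (1 - dRho) = 1) :
    H.tri.IHRelation (dRho : ℂ) (Real.sqrt dRho : ℂ) ((Real.sqrt dRho : ℂ) * p) where
  loop := H.cup_cap
  cup_merge := H.cup_merge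
  vertex_cap := H.vertex_cap
  bigon := H.vertex_merge
  rung := by
    have key : H.tri.rung = H.tri.merge ≫ V.vert .rho .rho .rho + ((Real.sqrt dRho : ℂ) * p) •
        (𝟙 (H.obj .rho ⊗ H.obj .rho) + (-1 : ℂ) • (H.capOne ≫ V.vert .rho .rho .one)) := by
      apply V.hom_ext
      intro c hc
      simp only [Preadditive.comp_add, Linear.comp_smul, Category.comp_id]
      have hc' : c = .one ∨ c = .rho ∨ c = .alRho ∨ c = .alSRho := by
        revert hc; cases c <;> decide
      have e1 : V.vert .rho .rho .one ≫ H.capOne ≫ V.vert .rho .rho .one =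
          (dRho : ℂ) • V.vert .rho .rho .one := by
        rw [V.vert_cup, ← Category.assoc, H.cupOne_capOne, Linear.smul_comp, Category.id_comp]
      have e2 : V.vert .rho .rho .rho ≫ H.tri.merge ≫ V.vert .rho .rho .rho =
          (Real.sqrt dRho : ℂ) • V.vert .rho .rho .rho := by
        rw [V.vert_vertex, ← Category.assoc, H.vertex_merge, Linear.smul_comp, Category.id_comp]
      have z1 : ∀ j ≠ H3Label.rho, V.vert .rho .rho j ≫ H.tri.merge ≫ V.vert .rho .rho .rho = 0 :=
        fun j hj => by rw [← Category.assoc, vert_merge_ne hj, zero_comp]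
      have z2 : ∀ j ≠ H3Label.one, V.vert .rho .rho j ≫ H.capOne ≫ V.vert .rho .rho .one = 0 :=
        fun j hj => by rw [← Category.assoc, vert_cap_ne hj, zero_comp]
      have h1' : (1 : ℂ) + p = a := by exact_mod_cast h1
      have h2' : (p : ℂ) * (1 - dRho) = 1 := by exact_mod_cast h2
      rcases hc' with rfl | rfl | rfl | rfl
      · rw [h.one, e1, z1 _ (by decide), zero_add]
        match_scalars
        linear_combination (-(Real.sqrt dRho : ℂ)) * h2'
      · rw [h.rho, e2, z2 _ (by decide), smul_zero, add_zero]
        match_scalars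
        linear_combination (-(Real.sqrt dRho : ℂ)) * h1'
      · rw [h.alRho, z1 _ (by decide), z2 _ (by decide), smul_zero, add_zero, zero_add]
      · rw [h.alSRho, z1 _ (by decide), z2 _ (by decide), smul_zero, add_zero, zero_add]
    rw [V.vert_vertex, V.vert_cup] at key
    exact key

theorem leftTree_difference :
    V.leftTree .rho .rho .rho .rho .alRho ≫ V.difference =
      star (V.F .rho .rho .rho .rho .one .alSRho) • 𝟙 _ := by
  rw [difference, Preadditive.comp_sub, Linear.comp_smul, Linear.comp_smul,
    V.leftTree_leftDual (by decide), V.leftTree_leftDual_ne (by decide), smul_zero, sub_zero]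

theorem _root_.dRho_eq_add_inv : dRho = 3 + dRho⁻¹ := by
  have h0 := dRho_pos.ne'
  have := dRho_sq
  field_simp
  linarith

theorem IsUnitary.rungEigenvalue_ne (hV : V.IsUnitary) {a p q : ℝ} (h : RungEigenvalues V a p q) :
    a ≠ (2 - dRho⁻¹) / 3 := by
  intro ha
  have he := inv_dRho_sq
  have hd := dRho_eq_add_inv
  have hpq : q = p := by
    have h1 := h.moment_one
    have h2 := h.moment_two
    -- For this value of `a` the first two moments make the discriminant of `p, q` vanish.
    have h3 : (p - q) ^ 2 = 0 := by
      rw [ha] at h1 h2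
      have h4 : q = -dRho⁻¹ - (2 - dRho⁻¹) / 3 - p := by linarith
      rw [h4] at h2 ⊢
      linear_combination 2 * h2 - 2 / 3 * he
    nlinarith
  subst hpq
  have hq : q = -(1 + dRho⁻¹) / 3 := by
    have h1 := h.moment_one
    rw [ha] at h1
    linarith
  have hIH := h.ihRelation (by rw [hq, ha]; ring) (by
    rw [hq]; nth_rw 2 [hd]; linear_combination he / 3)
  obtain ⟨η, hη⟩ : ∃ η : H3Label → ℂ, (∀ j ∈ H3Label.fusion .rho .rho,
      V.vert .rho .rho j ≫ H.tri.rung = η j • V.vert .rho .rho j) ∧ η .alRho = η .alSRho := by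
    refine ⟨fun | .one => (Real.sqrt dRho : ℂ) | .rho => (Real.sqrt dRho : ℂ) * a
                | _ => (Real.sqrt dRho : ℂ) * q, ?_, rfl⟩
    intro j hj
    have hj' : j = .one ∨ j = .rho ∨ j = .alRho ∨ j = .alSRho := by
      revert hj; cases j <;> decide
    rcases hj' with rfl | rfl | rfl | rfl
    exacts [h.one, h.rho, h.alRho, h.alSRho]
  have h1 : H.tri.cup ▷ H.obj .rho ≫ V.difference = 0 := by
    have := vert_difference (V := V) (c := .one) (by decide) (by decide)
    rw [V.vert_cup] at this
    exact this
  have h2 : H.tri.vertex ▷ H.obj .rho ≫ V.difference = 0 := by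
    have := vert_difference (V := V) (c := .rho) (by decide) (by decide)
    rw [V.vert_vertex] at this
    exact this
  -- The test diagram is the left tree through `_αρ` with its lower leg bent up by a cup. The closed
  -- functional takes on it the value `d` times a nonzero entry of `F`, a contradiction.
  have hzero := hIH.comp_eq_zero H.generated (H.tri.close V.difference)
    (fun n g hg => hg.comp_close h1 h2 hV.cupAt_difference (hV.vertAt_difference hη.1 hη.2)
      cupAt_difference_cap vertAt_difference_cap)
    (H.tri.cup ≫ V.leftTree .rho .rho .rho .rho .alRho ▷ H.obj .rho ≫
      (λ_ (H.obj .rho)).inv ▷ H.obj .rho ▷ H.obj .rho ▷ H.obj .rho)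
  have hval : (H.tri.cup ≫ V.leftTree .rho .rho .rho .rho .alRho ▷ H.obj .rho ≫
      (λ_ (H.obj .rho)).inv ▷ H.obj .rho ▷ H.obj .rho ▷ H.obj .rho) ≫ H.tri.close V.difference =
      (star (V.F .rho .rho .rho .rho .one .alSRho) * dRho) • 𝟙 (𝟙_ C) := by
    refine (Category.assoc _ _ _).trans ?_
    refine (congrArg (H.tri.cup ≫ ·) (H.tri.whiskerRight_comp_close _ _)).trans ?_
    rw [leftTree_difference, MonoidalLinear.smul_whiskerRight, id_whiskerRight, Linear.smul_comp,
      Linear.comp_smul, Category.id_comp, H.cup_cap, smul_smul]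
  rw [hval] at hzero
  have hF := hV.normSq_F_one.2.2.2
  rcases smul_eq_zero.1 hzero with h0 | h0
  · rcases mul_eq_zero.1 h0 with h0 | h0
    · rw [star_eq_zero.1 h0, map_zero] at hF
      exact inv_dRho_pos.ne hF
    · exact dRho_ne_zero h0
  · exact H.id_ne_zero .one h0

end Gauge

end H3Category

/-! ### Rotation symmetry, the constants and the conclusion -/

namespace TrivalentVertex

variable {C : Type u} [Category.{v} C] [MonoidalCategory C] {X : C} (T : TrivalentVertex X)
  [Preadditive C] [MonoidalPreadditive C]

theorem rotate_sum {ι : Type*} (s : Finset ι) {Y : C} (f : ι → (X ⟶ Y ⊗ X)) :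
    T.rotate (∑ k ∈ s, f k) = ∑ k ∈ s, T.rotate (f k) := by
  simp only [rotate, sum_whiskerRight, Preadditive.sum_comp, whiskerLeft_sum,
    Preadditive.comp_sum]

variable [Linear ℂ C] [MonoidalLinear ℂ C]

theorem rotate_smul (r : ℂ) {Y : C} (f : X ⟶ Y ⊗ X) : T.rotate (r • f) = r • T.rotate f := by
  simp only [rotate, MonoidalLinear.smul_whiskerRight, Linear.smul_comp,
    MonoidalLinear.whiskerLeft_smul, Linear.comp_smul]

end TrivalentVertex

namespace H3Category

variable {C : Type u} [Category.{v} C] [MonoidalCategory C] [Abelian C] [Linear ℂ C]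
  [MonoidalPreadditive C] [MonoidalLinear ℂ C] {H : H3Category C}

namespace Gauge

variable {V : H.Gauge}

/-- The upper vertex rides along under rotation, so only the lower vertex changes, within a
one-dimensional space. -/
theorem rotate_leftTree (k : H3Label) : ∃ r : ℂ, (V.RotationCompatible k → r = 1) ∧
    H.tri.rotate (V.leftTree .rho .rho .rho .rho k) = r • V.rightTree .rho .rho .rho .rho k := by
  have h1 : H.tri.rotate (V.leftTree .rho .rho .rho .rho k) =
      H.tri.rotate (V.vert k .rho .rho) ≫ H.obj .rho ◁ V.vert .rho .rho k := by
    rw [leftTree, TrivalentVertex.rotate_comp_whiskerRight]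
  rw [h1]
  by_cases hc : V.RotationCompatible k
  · refine ⟨1, fun _ => rfl, ?_⟩
    rw [one_smul, rightTree]
    exact congrArg (· ≫ H.obj .rho ◁ V.vert .rho .rho k) hc.symm
  · by_cases hk : H3Label.rho ∈ H3Label.fusion .rho k
    · obtain ⟨r, hr⟩ := V.exists_smul_vert hk (H.tri.rotate (V.vert k .rho .rho))
      refine ⟨r, fun h => absurd h hc, ?_⟩
      rw [hr, Linear.smul_comp, rightTree]
    · refine ⟨0, fun h => absurd h hc, ?_⟩
      rw [H.hom_tensor_eq_zero hk (H.tri.rotate (V.vert k .rho .rho)), zero_comp, zero_smul]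

/-- If rotating the right tree with middle label `j` gives the left tree with middle label `j`, then
the corresponding entries of the `F`-matrix and of its adjoint agree. -/
theorem IsUnitary.F_eq_star_of_rotate (hV : V.IsUnitary) {j k : H3Label}
    (hj : RightAdm .rho .rho .rho .rho j)
    (hrot : H.tri.rotate (V.rightTree .rho .rho .rho .rho j ≫ (α_ _ _ _).inv) =
      V.leftTree .rho .rho .rho .rho j ≫ (α_ _ _ _).hom)
    (hk : RightAdm .rho .rho .rho .rho k) (hc : V.RotationCompatible k) :
    V.F .rho .rho .rho .rho k j = star (V.F .rho .rho .rho .rho j k) := by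
  choose r hr hr' using fun k => rotate_leftTree (V := V) k
  have hj' : LeftAdm .rho .rho .rho .rho j := by revert hj; cases j <;> decide
  rw [hV.expand_inv hj, hV.expand hj hj', TrivalentVertex.rotate_sum] at hrot
  simp only [TrivalentVertex.rotate_smul, hr', smul_smul] at hrot
  have := V.rightTree_coeff hrot hk
  rw [← this, hr k hc, mul_one]

theorem vert_one_rho : V.vert .one .rho .rho = (λ_ (H.obj .rho)).inv := V.unit_left

theorem rotate_rightTree_one :
    H.tri.rotate (V.rightTree .rho .rho .rho .rho .one ≫ (α_ _ _ _).inv) =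
      V.leftTree .rho .rho .rho .rho .one ≫ (α_ _ _ _).hom := by
  rw [rightTree_one_inv, leftTree, V.vert_cup, vert_one_rho]
  exact H.tri.rotate_cup.trans (Category.assoc _ _ _).symm

theorem rotate_rightTree_rho :
    H.tri.rotate (V.rightTree .rho .rho .rho .rho .rho ≫ (α_ _ _ _).inv) =
      V.leftTree .rho .rho .rho .rho .rho ≫ (α_ _ _ _).hom := by
  rw [rightTree, leftTree, V.vert_vertex, Category.assoc, Category.assoc]
  exact H.tri.rotate_vertex_vertex

theorem IsUnitary.rung_eigenvalue_eq (hV : V.IsUnitary) {a p q : ℝ}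
    (h : RungEigenvalues V a p q) : a = -(1 + 2 * dRho⁻¹) / 3 := by
  rcases h.cases with h' | h' | h'
  · exact absurd h' (hV.rungEigenvalue_ne_zero h)
  · exact absurd h' (hV.rungEigenvalue_ne h)
  · exact h'

theorem _root_.sqrt_thirteen_eq : Real.sqrt 13 = 3 + 2 * dRho⁻¹ := by
  have := dRho_eq_add_inv
  nth_rw 1 [dRho] at this
  linarith

theorem _root_.popC2_eq : popC2 = Real.sqrt dRho * ((1 - dRho⁻¹) / 3) := by
  have h1 : Real.sqrt 13 - 2 = dRho * (1 - dRho⁻¹) ^ 2 := by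
    rw [sqrt_thirteen_eq]
    nth_rw 2 [dRho_eq_add_inv]
    have := inv_dRho_sq
    -- Both sides reduce to `1 + 2e`, using `d = 3 + e` and `e ^ 2 = 1 - 3e`.
    linear_combination (2 - dRho⁻¹) * this
  have h2 : (0 : ℝ) ≤ 1 - dRho⁻¹ := by linarith [inv_dRho_lt_one]
  rw [popC2, h1, Real.sqrt_mul dRho_pos.le, Real.sqrt_sq h2]
  ring

theorem _root_.popC1_eq {p q : ℝ} (h1 : p + q = (1 - dRho⁻¹) / 3)
    (h2 : dRho⁻¹ + ((1 + 2 * dRho⁻¹) / 3) ^ 2 + p ^ 2 + q ^ 2 = 1) :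
    popC1 = -dRho * (p * q) := by
  have h3 : q = (1 - dRho⁻¹) / 3 - p := by linarith
  have he := inv_dRho_sq
  rw [popC1, sqrt_thirteen_eq]
  have h4 : p * q = -(1 + 2 * dRho⁻¹) / 9 := by
    rw [h3] at h2 ⊢
    linear_combination (-1 / 2 : ℝ) * h2 + (5 / 18 : ℝ) * he
  rw [h4]
  nth_rw 2 [dRho_eq_add_inv]
  linear_combination (-2 / 9 : ℝ) * he

/-- The quadratic equation for the eigenvalue of the rung on an invertible translate of the
vertex. -/
theorem IsUnitary.eigenvalue_quadratic (hV : V.IsUnitary) {a p q : ℝ}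
    (h : RungEigenvalues V a p q) :
    (Real.sqrt dRho * p) ^ 2 = popC1 + popC2 * (Real.sqrt dRho * p) ∧
      (Real.sqrt dRho * q) ^ 2 = popC1 + popC2 * (Real.sqrt dRho * q) := by
  have ha := hV.rung_eigenvalue_eq h
  have h1 := h.moment_one
  have h2 := h.moment_two
  have hpq : p + q = (1 - dRho⁻¹) / 3 := by rw [ha] at h1; linarith
  have hc1 := popC1_eq hpq (by rw [ha] at h2; linarith)
  have hs := Real.sq_sqrt dRho_pos.le
  -- Now `c₂ = √d (p + q)` and `c₁ = -d p q`, so both claims say that `√d p` and `√d q` are the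
  -- roots of one quadratic (Vieta).
  rw [hc1, popC2_eq, ← hpq]
  constructor
  · linear_combination (- p * q) * hs
  · linear_combination (- p * q) * hs

theorem IsUnitary.F_relation (hV : V.IsUnitary) {h : H3Label → ℂ}
    (hh : ∀ j ∈ H3Label.fusion .rho .rho,
      V.vert .rho .rho j ≫ H.tri.rung = h j • V.vert .rho .rho j) {k : H3Label}
    (hk : LeftAdm .rho .rho .rho .rho k) {c₁ c₂ : ℂ} (hq : h k ^ 2 = c₁ + c₂ * h k) :
    star (V.F .rho .rho .rho .rho .rho k) * V.F .rho .rho .rho k .rho .rho *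
        (Real.sqrt dRho : ℂ) =
      c₁ * star (V.F .rho .rho .rho .rho .one k) + c₂ * star (V.F .rho .rho .rho .rho .rho k) := by
  have h1 : V.F .rho .rho .rho k .rho .rho * (Real.sqrt dRho : ℂ) = h k := by
    refine hV.F_rho_self (by decide) hk.1 ?_
    rw [V.vert_vertex]
    exact hh k hk.1
  rw [mul_assoc, h1, hV.star_F_rho_eq hh hk]
  linear_combination star (V.F .rho .rho .rho .rho .one k) * hq

end Gauge

end H3Category

theorem mainTheorem4 {C : Type u} [Category.{v} C] [MonoidalCategory C] [Abelian C] [Linear ℂ C]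
    [MonoidalPreadditive C] [MonoidalLinear ℂ C] (H : H3Category C) (V : H.Gauge)
    (hV : V.IsUnitary) :
    ((V.F .rho .rho .rho .rho).conjTranspose .alRho .rho * V.F .rho .rho .rho .alRho .rho .rho *
          (Real.sqrt dRho : ℂ) =
        (popC1 : ℂ) * (V.F .rho .rho .rho .rho).conjTranspose .alRho .one +
          (popC2 : ℂ) * (V.F .rho .rho .rho .rho).conjTranspose .alRho .rho ∧
      (V.F .rho .rho .rho .rho).conjTranspose .alSRho .rho * V.F .rho .rho .rho .alSRho .rho .rho *
          (Real.sqrt dRho : ℂ) =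
        (popC1 : ℂ) * (V.F .rho .rho .rho .rho).conjTranspose .alSRho .one +
          (popC2 : ℂ) * (V.F .rho .rho .rho .rho).conjTranspose .alSRho .rho) ∧
    (V.RotationCompatible .alRho →
      (V.F .rho .rho .rho .rho).conjTranspose .alRho .rho * V.F .rho .rho .rho .alRho .rho .rho *
          (Real.sqrt dRho : ℂ) =
        (popC1 : ℂ) * V.F .rho .rho .rho .rho .alRho .one +
          (popC2 : ℂ) * V.F .rho .rho .rho .rho .alRho .rho) ∧
    (V.RotationCompatible .alSRho →
      (V.F .rho .rho .rho .rho).conjTranspose .alSRho .rho * V.F .rho .rho .rho .alSRho .rho .rho *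
          (Real.sqrt dRho : ℂ) =
        (popC1 : ℂ) * V.F .rho .rho .rho .rho .alSRho .one +
          (popC2 : ℂ) * V.F .rho .rho .rho .rho .alSRho .rho) := by
  obtain ⟨a, p, q, h⟩ := hV.exists_rungEigenvalues
  obtain ⟨hp, hq⟩ := hV.eigenvalue_quadratic h
  obtain ⟨η, hη, hx, hy⟩ : ∃ η : H3Label → ℂ, (∀ j ∈ H3Label.fusion .rho .rho,
      V.vert .rho .rho j ≫ H.tri.rung = η j • V.vert .rho .rho j) ∧
      η .alRho ^ 2 = popC1 + popC2 * η .alRho ∧ η .alSRho ^ 2 = popC1 + popC2 * η .alSRho := by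
    -- The default branch supplies the eigenvalue for `_{α*}ρ`; its value on `α` and `α*`, which do
    -- not occur in `ρ ⊗ ρ`, is irrelevant.
    refine ⟨fun | .one => (Real.sqrt dRho : ℂ) | .rho => (Real.sqrt dRho : ℂ) * a
                | .alRho => (Real.sqrt dRho : ℂ) * p | _ => (Real.sqrt dRho : ℂ) * q,
      ?_, ?_, ?_⟩
    rotate_left
    · dsimp only; exact_mod_cast hp
    · dsimp only; exact_mod_cast hq
    intro j hj
    have hj' : j = .one ∨ j = .rho ∨ j = .alRho ∨ j = .alSRho := by
      revert hj; cases j <;> decide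
    rcases hj' with rfl | rfl | rfl | rfl
    exacts [h.one, h.rho, h.alRho, h.alSRho]
  have hkx := hV.F_relation hη (k := .alRho) (by decide) hx
  have hky := hV.F_relation hη (k := .alSRho) (by decide) hy
  simp only [Matrix.conjTranspose_apply]
  refine ⟨⟨hkx, hky⟩, fun hc => ?_, fun hc => ?_⟩
  -- The right trees through `1` and `ρ` rotate to left trees without a scalar, because a gauge
  -- fixes all their vertices.
  · rw [hV.F_eq_star_of_rotate (by decide) H3Category.Gauge.rotate_rightTree_one (by decide) hc,
      hV.F_eq_star_of_rotate (by decide) H3Category.Gauge.rotate_rightTree_rho (by decide) hc]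
    exact hkx
  · rw [hV.F_eq_star_of_rotate (by decide) H3Category.Gauge.rotate_rightTree_one (by decide) hc,
      hV.F_eq_star_of_rotate (by decide) H3Category.Gauge.rotate_rightTree_rho (by decide) hc]
    exact hky
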